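/- Let $\mathbb T$ be the unit circle with normalized arclength $\mu$, let $H^2\subset L^2(\mathbb T)$ be the classical Hardy space, and for a subspace $\mathcal V\subset\mathbb C\oplus\mathbb Cz$ let $H^2_{\mathcal V}=H^2\ominus\mathcal V$. For real-valued $\phi\in L^\infty(\mathbb T)$ let $T^{\mathcal V}_\phi$ be the Toeplitz operator $f\mapsto P_{\mathcal V}(\phi f)$ on $H^2_{\mathcal V}$, where $P_{\mathcal V}$ is the orthogonal projection of $L^2(\mathbb T)$ onto $H^2_{\mathcal V}$. Suppose that there are $c\in\mathbb C$ and real numbers $m<0<M$ such that $$\operatorname{ess\,sup}\{\phi(z): cz+\overline{cz}<0\}=m<0<M=\operatorname{ess\,inf}\{\phi(z): cz+\overline{cz}>0\}.$$ With $H(z,t)=\frac{e^{it}+z}{e^{it}-z}$ put, for $|z|<1$ and $\lambda\in(m,M)$, $$h_c(z)=\exp\Big(\frac1{2\pi}\int_{-\pi}^{\pi}H(z,t)\log|ce^{it}+\bar c e^{-it}|^{1/2}\,dt\Big),\qquad g_\lambda(z)=\exp\Big(\frac1{2\pi}\int_{-\pi}^{\pi}H(z,t)\log|\phi(e^{it})-\lambda|^{-1/2}\,dt\Big).$$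 These logarithms are integrable, and $h_c$ and $g_\lambda$ are complex differentiable at $0$, so that a map $\Lambda:(m,M)\to\mathbb P^1(\mathbb C)$ is defined by $$\Lambda(\lambda)=\big[\,h_c(0)g_\lambda(0)\;:\;h_c'(0)g_\lambda(0)+h_c(0)g_\lambda'(0)\,\big].$$ Let $\mathbb P^1(\mathbb C)$ carry its usual (chordal) metric, in which the distance of two lines in $\mathbb C^2$ is the sine of the angle between them. Then: 1. $\Lambda$ is locally Lipschitz on $(m,M)$. 2. The image $\Lambda((m,M))$ has Hausdorff dimension at most one. 3. For $\mathcal V=\operatorname{span}\{1\}$ the operator $T^{\mathcal V}_\phi$ has no eigenvalues; besides this $\mathcal V$ there are other (indeed infinitely many) nonzero proper subspaces $\mathcal V\subset\mathbb C\oplus\mathbb Cz$ for which $T^{\mathcal V}_\phi$ has no eigenvalues. -/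

import Mathlib

open MeasureTheory Set AddCircle
open scoped ENNReal LinearAlgebra.Projectivization ComplexConjugate

noncomputable section

namespace NeilParabola

/-- The period `2π` is positive (this makes `AddCircle (2π)` a compact circle in Mathlib). -/
instance instFactTwoPiPos : Fact (0 < 2 * Real.pi) := ⟨Real.two_pi_pos⟩

/-- The unit circle, parametrized by the angle `t` modulo `2π`; the coordinate function
`z = e^{it}` is `fourier 1`. -/
abbrev Torus : Type := AddCircle (2 * Real.pi)

/-- Normalized arclength measure `dt / 2π`. -/
abbrev arc : Measure Torus := haarAddCircle

/-- The space `L²` of the circle. -/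
abbrev L2 : Type := Lp ℂ 2 arc

/-! ### Hardy space and its subspaces -/

/-- The Hardy space `H²`: the closure in `L²` of the span of `z ^ n`, `n = 0, 1, 2, …`. -/
def hardy : Submodule ℂ L2 :=
  (Submodule.span ℂ (range fun n : ℕ => (fourierLp 2 (n : ℤ) : L2))).topologicalClosure

/-- The space `ℂ ⊕ ℂ z` spanned in `L²` by `1` and `z`. -/
def linearPolys : Submodule ℂ L2 :=
  Submodule.span ℂ {(fourierLp 2 0 : L2), (fourierLp 2 1 : L2)}

/-- The span of the constant function `1`. -/
def constants : Submodule ℂ L2 :=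
  Submodule.span ℂ {(fourierLp 2 0 : L2)}

/-- `H²_V = H² ⊖ V`, the functions in `H²` that are orthogonal to `V`. -/
def hardySub (V : Submodule ℂ L2) : Submodule ℂ L2 := hardy ⊓ Vᗮ

theorem isClosed_hardySub (V : Submodule ℂ L2) : IsClosed (hardySub V : Set L2) :=
  (Submodule.isClosed_topologicalClosure _).inter (Submodule.isClosed_orthogonal V)

instance instCompleteHardySub (V : Submodule ℂ L2) : CompleteSpace (hardySub V) :=
  (isClosed_hardySub V).completeSpace_coe

/-! ### Toeplitz operators -/

/-- Multiplication by a real function `φ ∈ L^∞`, as a bounded operator on `L²`. -/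
def mulOp (φ : Lp ℝ ∞ arc) : L2 →L[ℂ] L2 :=
  LinearMap.mkContinuous
    { toFun := fun f => (φ • f : L2)
      map_add' := fun f g => Lp.add_smul φ f g
      map_smul' := fun a f => by
        refine Lp.ext ?_
        filter_upwards [Lp.coeFn_lpSMul φ (a • f) (r := 2), Lp.coeFn_lpSMul φ f (r := 2),
          Lp.coeFn_smul a f, Lp.coeFn_smul a (φ • f : L2)] with x h1 h2 h3 h4
        simp only [RingHom.id_apply]
        rw [h1, h4, Pi.smul_apply', Pi.smul_apply, h2, h3, Pi.smul_apply, Pi.smul_apply',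
          smul_comm] }
    ‖φ‖ (fun f => Lp.norm_smul_le φ f)

/-- The Toeplitz operator `f ↦ P_V (φ f)` on `H²_V`, where `P_V` is the orthogonal projection
of `L²` onto `H²_V`. -/
def toeplitz (φ : Lp ℝ ∞ arc) (V : Submodule ℂ L2) : hardySub V →L[ℂ] hardySub V :=
  (hardySub V).orthogonalProjectionOnto ∘L mulOp φ ∘L (hardySub V).subtypeL

/-- The Toeplitz operator with symbol `φ` on `H²_V` has no eigenvalues. -/
def NoEigenvalues (φ : Lp ℝ ∞ arc) (V : Submodule ℂ L2) : Prop :=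
  ∀ a : ℂ, ¬ Module.End.HasEigenvalue
    (toeplitz φ V : hardySub V →ₗ[ℂ] hardySub V) a

/-! ### The outer functions -/

/-- The real number `c z + (c z)^*` at the point `z = e^{it}`. -/
def neilWeight (c : ℂ) (t : Torus) : ℝ := 2 * (c * fourier 1 t).re

/-- The kernel `H(z, t) = (e^{it} + z) / (e^{it} - z)`. -/
def herglotz (z : ℂ) (t : Torus) : ℂ := (fourier 1 t + z) / (fourier 1 t - z)

/-- `z ↦ exp ((1 / 2π) ∫ H(z, t) u(t) dt)`; on the unit disc this is, for `u` integrable, the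
outer function whose modulus on the circle is `exp u`. -/
def outerExp (u : Torus → ℝ) (z : ℂ) : ℂ :=
  Complex.exp (∫ t, herglotz z t * (u t : ℂ) ∂arc)

/-- `log |c e^{it} + c^* e^{-it}|^{1/2}`. -/
def hLog (c : ℂ) (t : Torus) : ℝ := Real.log (|neilWeight c t| ^ (1 / 2 : ℝ))

/-- `log |φ(t) - λ|^{-1/2}`. -/
def gLog (φ : Lp ℝ ∞ arc) (lam : ℝ) (t : Torus) : ℝ := Real.log (|φ t - lam| ^ (-1 / 2 : ℝ))

/-- The function `h_c`. -/
def hFun (c : ℂ) : ℂ → ℂ := outerExp (hLog c)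

/-- The function `g_λ`. -/
def gFun (φ : Lp ℝ ∞ arc) (lam : ℝ) : ℂ → ℂ := outerExp (gLog φ lam)

/-! ### The complex projective line -/

/-- `ℂ²` with its Hermitian norm. -/
abbrev C2 : Type := EuclideanSpace ℂ (Fin 2)

/-- The orthogonal projection of `ℂ²` onto a line through the origin. -/
def lineProj (p : ℙ ℂ C2) : C2 →L[ℂ] C2 := p.submodule.starProjection

theorem lineProj_injective : Function.Injective lineProj := fun _ _ h =>
  Projectivization.submodule_injective (Submodule.starProjection_inj.1 h)

/-- The standard metric of the complex projective line: the distance of two lines is the operator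
norm of the difference of the orthogonal projections onto them, that is, the sine of the angle
between them (`|v₀ w₁ - v₁ w₀| / (‖v‖ ‖w‖)` for the lines through `v` and `w`). It is half the
chordal metric of the Riemann sphere, and is bi-Lipschitz equivalent to the metric of `ℂ` on compact
subsets of the two affine charts `[ζ, 1]` and `[1, ξ]`. -/
instance instMetricProjLine : MetricSpace (ℙ ℂ C2) :=
  MetricSpace.induced lineProj lineProj_injective inferInstance

/-- The vector `(h_c(0) g_λ(0), h_c'(0) g_λ(0) + h_c(0) g_λ'(0))`. -/
def lamVec (c : ℂ) (φ : Lp ℝ ∞ arc) (lam : ℝ) : C2 :=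
  !₂[hFun c 0 * gFun φ lam 0,
    deriv (hFun c) 0 * gFun φ lam 0 + hFun c 0 * deriv (gFun φ lam) 0]

theorem lamVec_ne_zero (c : ℂ) (φ : Lp ℝ ∞ arc) (lam : ℝ) : lamVec c φ lam ≠ 0 := by
  intro h
  have h0 : (lamVec c φ lam) 0 = 0 := by rw [h]; rfl
  have h1 : hFun c 0 * gFun φ lam 0 = 0 := h0
  exact mul_ne_zero (Complex.exp_ne_zero _) (Complex.exp_ne_zero _) h1

/-- The map `Λ`. -/
def lamMap (c : ℂ) (φ : Lp ℝ ∞ arc) (lam : ℝ) : ℙ ℂ C2 :=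
  Projectivization.mk ℂ (lamVec c φ lam) (lamVec_ne_zero c φ lam)

end NeilParabola

end

open NeilParabola

namespace NeilParabola

open Filter Topology

/-! ### The circle -/

/-! The operator is symmetric, so an eigenvalue is a real `λ`. If `f` is an eigenvector and `F = (φ
- λ) f`, then `F` is orthogonal to `H²_V`, hence to `zⁿ` for `n ≥ 2` and to `f` itself. Thus `g = z
F̄` lies in `H²`, and the real function `q = (φ - λ)|f|²` has mean zero and only frequencies `±1`:
`q = az + (az)^*`, and `f g = z q = ā + a z²` (`exists_factorization_of_hasEigenvalue`).

For `a ≠ 0` this polynomial has its zeros on the circle, so `f` and `g` are zero-free in the disc.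
Each satisfies a Jensen inequality with weight `1 + Re(ηz)`
(`log_coeff_le_integral_weight_mul_log_norm`). The two inequalities add up to an equality for the
polynomial, so both are equalities; this replaces the inner-outer factorization. Varying `η` gives
`f'(0)/f(0) = 2 ∫ z̄ log|f|`. Since `2 log|f| = log|q| - log|φ - λ|`, and `log|q|` has no first
moment because `|q|` is invariant under `z ↦ -z`, the ratio is `logMoment φ λ`, a function of `λ`
alone (`coeff_ratio_eq_logMoment`). Comparing signs on the two half circles excludes `a = 0` and
puts `λ` in `[m, M]`.

The same symmetry gives `h_c'(0) = 0`, so `Λ(λ) = [1 : logMoment φ λ]`. As `|φ - λ|` is bounded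
below locally uniformly in `λ`, the logarithm is Lipschitz there; hence so are `logMoment` and `Λ`,
and their images have dimension at most one.

An eigenvector has `f(0) ≠ 0`, which is impossible if `f ⟂ 1`. If `V` is spanned by `z - ζ̄`, then
`f'(0) = ζ f(0)`, so an eigenvalue forces `ζ` onto the curve `logMoment φ '' [m, M]`. The curve has
dimension at most one in the plane and misses infinitely many `ζ`. -/

theorem norm_fourier_apply (n : ℤ) (t : Torus) : ‖fourier n t‖ = 1 := by
  rw [fourier_apply, Circle.norm_coe]

theorem fourier_one_eq_circleMap (θ : ℝ) : fourier 1 (θ : Torus) = circleMap 0 1 θ := by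
  rw [fourier_coe_apply, circleMap]
  have : (Real.pi : ℂ) ≠ 0 := by exact_mod_cast Real.pi_ne_zero
  push_cast
  rw [zero_add, one_mul]
  congr 1
  field_simp

theorem fourier_natCast (n : ℕ) (t : Torus) : fourier (n : ℤ) t = fourier 1 t ^ n := by
  induction n with
  | zero => simp
  | succ n ih => rw [Nat.cast_succ, fourier_add, ih, pow_succ]

theorem fourier_one_mul_conj (t : Torus) : fourier 1 t * conj (fourier 1 t) = 1 := by
  rw [Complex.mul_conj, Complex.normSq_eq_norm_sq, norm_fourier_apply]; simp

theorem fourier_one_ne_zero (t : Torus) : fourier 1 t ≠ 0 := by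
  rw [← norm_pos_iff, norm_fourier_apply]; exact one_pos

theorem circleAverage_zero_one_eq_integral {E : Type*} [NormedAddCommGroup E] [NormedSpace ℝ E]
    (f : ℂ → E) : Real.circleAverage f 0 1 = ∫ t, f (fourier 1 t) ∂arc := by
  rw [Real.circleAverage_def, integral_haarAddCircle,
    ← AddCircle.intervalIntegral_preimage (2 * Real.pi) 0]
  simp_rw [fourier_one_eq_circleMap, zero_add]

theorem integrable_of_circleIntegrable {E : Type*} [NormedAddCommGroup E]
    {f : ℂ → E} (hfm : StronglyMeasurable f) (hf : CircleIntegrable f 0 1) :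
    Integrable (fun t => f (fourier 1 t)) arc := by
  have h1 : IntervalIntegrable (fun θ : ℝ => f (fourier 1 (θ : Torus))) volume
      0 (0 + 2 * Real.pi) := by
    simp_rw [fourier_one_eq_circleMap, zero_add]
    exact hf
  rw [intervalIntegrable_iff_integrableOn_Ioc_of_le (by linarith [Real.two_pi_pos])] at h1
  have h2 : Integrable (fun t : Torus => f (fourier 1 t)) volume :=
    ((AddCircle.measurePreserving_mk (2 * Real.pi) 0).integrable_comp
      (hfm.comp_measurable (map_continuous (fourier 1)).measurable).aestronglyMeasurable).1 h1
  rw [volume_eq_smul_haarAddCircle] at h2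
  exact (integrable_smul_measure (by simp [Real.pi_pos])
    ENNReal.ofReal_ne_top).1 h2

theorem fourier_one_add_pi (t : Torus) :
    fourier 1 (t + ((Real.pi : ℝ) : Torus)) = -fourier 1 t := by
  induction t using QuotientAddGroup.induction_on with
  | H x =>
    have h : ((x : Torus) + ((Real.pi : ℝ) : Torus)) = ((x + Real.pi : ℝ) : Torus) := rfl
    rw [h, fourier_one_eq_circleMap, fourier_one_eq_circleMap]
    simp [circleMap, add_mul, Complex.exp_add]

theorem ae_fourier_one_ne (a : ℂ) : ∀ᵐ t ∂arc, fourier 1 t ≠ a := by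
  -- Nontriviality of the circle is what makes Haar measure free of atoms.
  have : Nontrivial Torus := by
    refine ⟨⟨0, 0 + ((Real.pi : ℝ) : Torus), fun h => ?_⟩⟩
    have h1 := fourier_one_add_pi 0
    rw [← h] at h1
    exact fourier_one_ne_zero 0 (self_eq_neg.1 h1)
  have : NullSingletonClass arc := inferInstance
  have hs : {t : Torus | fourier 1 t = a}.Subsingleton := by
    intro s hs t ht
    have h : toCircle s = toCircle t := by
      apply Subtype.ext
      have h1 : fourier 1 s = fourier 1 t := hs.trans ht.symm
      simpa [fourier_one] using h1
    exact AddCircle.injective_toCircle Real.two_pi_pos.ne' h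
  rw [ae_iff]
  simpa using hs.measure_zero arc

theorem ae_add_pi {p : Torus → Prop} (h : ∀ᵐ t ∂arc, p t) :
    ∀ᵐ t ∂arc, p (t + ((Real.pi : ℝ) : Torus)) :=
  (measurePreserving_add_right arc ((Real.pi : ℝ) : Torus)).quasiMeasurePreserving.ae h

/-! ### Fourier coefficients -/

/-- Parseval for `f` against `zⁿ ḡ`, whose `j`-th coefficient is the conjugate of `ĝ(n - j)`. The
product itself is only integrable. -/
theorem fourierCoeff_mul_eq_tsum {f g : Torus → ℂ} (hf : MemLp f 2 arc) (hg : MemLp g 2 arc)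
    (n : ℤ) : HasSum (fun j => fourierCoeff f j * fourierCoeff g (n - j))
      (fourierCoeff (fun t => f t * g t) n) := by
  have hk : MemLp (fun t => fourier n t * conj (g t)) 2 arc := by
    refine (hg.star).of_le_mul (c := 1) ?_ (ae_of_all _ fun t => ?_)
    · exact (map_continuous (fourier n)).aestronglyMeasurable.mul hg.star.1
    · simp [norm_fourier_apply, -fourier_apply]
  have h := (fourierBasis (T := 2 * Real.pi)).hasSum_inner_mul_inner (hk.toLp _) (hf.toLp _)
  have hco : ∀ j, inner ℂ (fourierBasis j) (hf.toLp f) = fourierCoeff f j := by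
    intro j
    rw [← HilbertBasis.repr_apply_apply, fourierBasis_repr]
    exact congrFun (fourierCoeff_congr_ae hf.coeFn_toLp) j
  have hco2 : ∀ j, inner ℂ (hk.toLp _) (fourierBasis j) = fourierCoeff g (n - j) := by
    intro j
    rw [← inner_conj_symm, ← HilbertBasis.repr_apply_apply, fourierBasis_repr,
      congrFun (fourierCoeff_congr_ae hk.coeFn_toLp) j, fourierCoeff, fourierCoeff, ← integral_conj]
    congr 1
    ext t
    simp only [smul_eq_mul, map_mul, Complex.conj_conj, ← fourier_neg, neg_neg]
    rw [← mul_assoc, ← fourier_add]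
    congr 3; ring
  have hin : inner ℂ (hk.toLp _) (hf.toLp f) = fourierCoeff (fun t => f t * g t) n := by
    rw [L2.inner_def, fourierCoeff]
    refine integral_congr_ae ?_
    filter_upwards [hf.coeFn_toLp, hk.coeFn_toLp] with t h1 h2
    rw [h1, h2]
    simp only [RCLike.inner_apply, map_mul, Complex.conj_conj, smul_eq_mul, fourier_neg]
    ring
  rw [← hin]
  refine h.congr_fun fun j => ?_
  rw [hco, hco2, mul_comm]

theorem fourierCoeff_mul_of_nonneg {f g : Torus → ℂ} (hf : MemLp f 2 arc) (hg : MemLp g 2 arc)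
    (hf0 : ∀ n < 0, fourierCoeff f n = 0) (hg0 : ∀ n < 0, fourierCoeff g n = 0) (n : ℕ) :
    fourierCoeff (fun t => f t * g t) n =
      ∑ p ∈ Finset.HasAntidiagonal.antidiagonal n, fourierCoeff f p.1 * fourierCoeff g p.2 := by
  refine (fourierCoeff_mul_eq_tsum hf hg n).unique ?_
  rw [Finset.Nat.sum_antidiagonal_eq_sum_range_succ
    (fun i j => fourierCoeff f i * fourierCoeff g j)]
  have h := hasSum_sum_of_ne_finset_zero (s := (Finset.range (n + 1)).map Nat.castEmbedding)
    (f := fun j : ℤ => fourierCoeff f j * fourierCoeff g (n - j)) (L := .unconditional _) ?_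
  · rw [Finset.sum_map] at h
    convert h using 1
    refine Finset.sum_congr rfl fun k hk => ?_
    have : k ≤ n := by simpa [Nat.lt_succ_iff] using hk
    simp [Nat.cast_sub this]
  · intro j hj
    by_cases h0 : j < 0
    · rw [hf0 j h0, zero_mul]
    · rw [hg0, mul_zero]
      by_contra hc
      refine hj (Finset.mem_map.2 ⟨j.toNat, ?_, ?_⟩)
      · rw [Finset.mem_range]; omega
      · simp; omega

theorem fourierCoeff_mul_of_neg {f g : Torus → ℂ} (hf : MemLp f 2 arc) (hg : MemLp g 2 arc)
    (hf0 : ∀ n < 0, fourierCoeff f n = 0) (hg0 : ∀ n < 0, fourierCoeff g n = 0) {n : ℤ}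
    (hn : n < 0) : fourierCoeff (fun t => f t * g t) n = 0 := by
  refine (fourierCoeff_mul_eq_tsum hf hg n).unique ?_
  refine hasSum_zero.congr_fun fun j => ?_
  by_cases h0 : j < 0
  · rw [hf0 j h0, zero_mul]
  · rw [hg0 _ (by omega), mul_zero]

/-- For a merely integrable `q` the `L²` basis says nothing. Instead `q` annihilates trigonometric
polynomials, hence by density all continuous functions, hence indicators of closed sets as dominated
limits. -/
theorem ae_eq_zero_of_fourierCoeff_eq_zero {q : Torus → ℂ} (hq : Integrable q arc)
    (h : ∀ n, fourierCoeff q n = 0) : q =ᵐ[arc] 0 := by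
  have hcont : ∀ g : C(Torus, ℂ), ∫ t, g t * q t ∂arc = 0 := by
    have hgq : ∀ g : C(Torus, ℂ), Integrable (fun t => g t * q t) arc := fun g =>
      hq.bdd_mul (c := ‖g‖) (map_continuous g).aestronglyMeasurable
        (ae_of_all _ fun t => g.norm_coe_le_norm t)
    let Φ : C(Torus, ℂ) →L[ℂ] ℂ := LinearMap.mkContinuous
      { toFun := fun g => ∫ t, g t * q t ∂arc
        map_add' := fun a b => by
          simp only [ContinuousMap.add_apply, add_mul]
          exact integral_add (hgq a) (hgq b)
        map_smul' := fun a b => by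
          simp only [ContinuousMap.smul_apply, smul_eq_mul, mul_assoc, RingHom.id_apply]
          exact integral_const_mul _ _ }
      (∫ t, ‖q t‖ ∂arc) (fun g => by
        refine (norm_integral_le_integral_norm _).trans ?_
        rw [mul_comm (∫ t, ‖q t‖ ∂arc), ← integral_const_mul]
        refine integral_mono (hgq g).norm (hq.norm.const_mul _) fun t => ?_
        simp only [norm_mul]
        gcongr
        exact g.norm_coe_le_norm t)
    have hle : (Submodule.span ℂ (range (fourier (T := 2 * Real.pi)))).topologicalClosure
        ≤ LinearMap.ker (Φ : C(Torus, ℂ) →ₗ[ℂ] ℂ) := by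
      refine Submodule.topologicalClosure_minimal _ (Submodule.span_le.2 ?_) Φ.isClosed_ker
      rintro _ ⟨n, rfl⟩
      have h1 := h (-n)
      rw [fourierCoeff, neg_neg] at h1
      exact h1
    intro g
    rw [span_fourier_closure_eq_top] at hle
    exact hle (Submodule.mem_top (x := g))
  refine ae_eq_zero_of_forall_setIntegral_isClosed_eq_zero hq fun s hs => ?_
  rw [← integral_indicator hs.measurableSet]
  have hlim : Tendsto (fun n => ∫ t, (((hs.apprSeq n t : ℝ) : ℂ)) * q t ∂arc) atTop
      (𝓝 (∫ t, s.indicator q t ∂arc)) := by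
    refine tendsto_integral_of_dominated_convergence (fun t => ‖q t‖) (fun n => ?_) hq.norm
      (fun n => ae_of_all _ fun t => ?_) (ae_of_all _ fun t => ?_)
    · refine AEStronglyMeasurable.mul ?_ hq.1
      exact (Complex.continuous_ofReal.comp (NNReal.continuous_coe.comp
        (map_continuous (hs.apprSeq n)))).aestronglyMeasurable
    · rw [norm_mul]
      refine mul_le_of_le_one_left (norm_nonneg _) ?_
      have := HasOuterApproxClosed.apprSeq_apply_le_one hs n t
      simpa using this
    · have h1 := (tendsto_pi_nhds.1 (HasOuterApproxClosed.tendsto_apprSeq hs)) t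
      have h2 : Tendsto (fun n => ((hs.apprSeq n t : ℝ) : ℂ)) atTop
          (𝓝 (((s.indicator (fun _ => (1 : NNReal)) t : NNReal) : ℝ) : ℂ)) :=
        (Complex.continuous_ofReal.tendsto _).comp ((NNReal.continuous_coe.tendsto _).comp h1)
      have h3 := h2.mul_const (q t)
      convert h3 using 2
      by_cases ht : t ∈ s <;> simp [ht]
  refine tendsto_nhds_unique hlim ?_
  have : ∀ n, ∫ t, (((hs.apprSeq n t : ℝ) : ℂ)) * q t ∂arc = 0 := fun n =>
    hcont ⟨fun t => ((hs.apprSeq n t : ℝ) : ℂ), Complex.continuous_ofReal.comp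
      (NNReal.continuous_coe.comp (map_continuous (hs.apprSeq n)))⟩
  simp [this]

/-! ### The analytic extension of a function on the circle -/

/-- The power series `∑ f̂(n) zⁿ` formed with the nonnegative Fourier coefficients of `f`. -/
noncomputable def diskExt (f : Torus → ℂ) (z : ℂ) : ℂ := ∑' n : ℕ, fourierCoeff f n * z ^ n

theorem norm_fourierCoeff_le (f : Torus → ℂ) (n : ℤ) :
    ‖fourierCoeff f n‖ ≤ ∫ t, ‖f t‖ ∂arc := by
  refine (norm_integral_le_integral_norm _).trans_eq ?_
  simp only [smul_eq_mul, norm_mul, norm_fourier_apply, one_mul]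

theorem summable_norm_fourierCoeff_mul_pow (f : Torus → ℂ) {z : ℂ} (hz : ‖z‖ < 1) :
    Summable fun n : ℕ => ‖fourierCoeff f n * z ^ n‖ := by
  refine Summable.of_nonneg_of_le (fun n => norm_nonneg _) (fun n => ?_)
    ((summable_geometric_of_lt_one (norm_nonneg z) hz).mul_left (∫ t, ‖f t‖ ∂arc))
  rw [norm_mul, norm_pow]
  gcongr
  exact norm_fourierCoeff_le f n

theorem hasFPowerSeriesOnBall_diskExt (f : Torus → ℂ) :
    HasFPowerSeriesOnBall (diskExt f)
      (FormalMultilinearSeries.ofScalars ℂ fun n : ℕ => fourierCoeff f n) 0 1 := by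
  set p := FormalMultilinearSeries.ofScalars ℂ fun n : ℕ => fourierCoeff f n with hp
  have hr : (1 : ℝ≥0∞) ≤ p.radius := by
    refine p.le_radius_of_bound (∫ t, ‖f t‖ ∂arc) (r := 1) fun n => ?_
    rw [NNReal.coe_one, one_pow, mul_one, hp, FormalMultilinearSeries.ofScalars_norm]
    exact norm_fourierCoeff_le f n
  have h := (p.hasFPowerSeriesOnBall (zero_lt_one.trans_le hr)).mono one_pos hr
  refine h.congr fun z _ => ?_
  rw [FormalMultilinearSeries.sum, diskExt]
  refine tsum_congr fun n => ?_
  rw [hp, FormalMultilinearSeries.ofScalars_apply_eq, smul_eq_mul]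

theorem differentiableOn_diskExt (f : Torus → ℂ) :
    DifferentiableOn ℂ (diskExt f) (Metric.ball 0 1) := by
  have h := (hasFPowerSeriesOnBall_diskExt f).differentiableOn
  rwa [show (1 : ℝ≥0∞) = ENNReal.ofReal 1 by simp, Metric.eball_ofReal] at h

theorem diskExt_zero (f : Torus → ℂ) : diskExt f 0 = fourierCoeff f 0 := by
  rw [diskExt, tsum_eq_single 0 fun n hn => by simp [hn]]
  simp

theorem deriv_diskExt_zero (f : Torus → ℂ) : deriv (diskExt f) 0 = fourierCoeff f 1 := by
  rw [(hasFPowerSeriesOnBall_diskExt f).hasFPowerSeriesAt.deriv,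
    FormalMultilinearSeries.ofScalars_apply_eq]
  simp

theorem diskExt_mul {f g : Torus → ℂ} (hf : MemLp f 2 arc) (hg : MemLp g 2 arc)
    (hf0 : ∀ n < 0, fourierCoeff f n = 0) (hg0 : ∀ n < 0, fourierCoeff g n = 0) {z : ℂ}
    (hz : ‖z‖ < 1) : diskExt f z * diskExt g z = diskExt (fun t => f t * g t) z := by
  rw [diskExt, diskExt, diskExt, tsum_mul_tsum_eq_tsum_sum_antidiagonal_of_summable_norm
    (summable_norm_fourierCoeff_mul_pow f hz) (summable_norm_fourierCoeff_mul_pow g hz)]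
  refine tsum_congr fun n => ?_
  rw [fourierCoeff_mul_of_nonneg hf hg hf0 hg0, Finset.sum_mul]
  refine Finset.sum_congr rfl fun p hp => ?_
  rw [← Finset.HasAntidiagonal.mem_antidiagonal.1 hp, pow_add]
  ring

theorem norm_ofReal_mul_fourier_lt_one {r : ℝ} (hr0 : 0 ≤ r) (hr : r < 1) (t : Torus) :
    ‖(r : ℂ) * fourier 1 t‖ < 1 := by
  rw [norm_mul, norm_fourier_apply, mul_one, Complex.norm_real, Real.norm_of_nonneg hr0]
  exact hr

theorem continuous_diskExt_radial (f : Torus → ℂ) {r : ℝ} (hr0 : 0 ≤ r) (hr : r < 1) :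
    Continuous fun t : Torus => diskExt f (r * fourier 1 t) :=
  (differentiableOn_diskExt f).continuousOn.comp_continuous
    (continuous_const.mul (map_continuous (fourier (T := 2 * Real.pi) 1)))
    fun t => by simpa using norm_ofReal_mul_fourier_lt_one hr0 hr t

theorem fourierCoeff_diskExt_radial (f : Torus → ℂ) {r : ℝ} (hr0 : 0 ≤ r) (hr : r < 1) (m : ℤ) :
    fourierCoeff (fun t : Torus => diskExt f (r * fourier 1 t)) m =
      if 0 ≤ m then fourierCoeff f m * (r : ℂ) ^ m.toNat else 0 := by
  have hr' : ‖(r : ℂ)‖ < 1 := by rwa [Complex.norm_real, Real.norm_of_nonneg hr0]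
  have hterm : ∀ n : ℕ, ∫ t, fourier (-m) t * (fourierCoeff f n * (r * fourier 1 t) ^ n) ∂arc
      = if (n : ℤ) = m then fourierCoeff f n * (r : ℂ) ^ n else 0 := by
    intro n
    have h1 := congrFun (fourierCoeff_fourier (T := 2 * Real.pi) n) m
    rw [fourierCoeff] at h1
    have h2 : ∀ t : Torus, fourier (-m) t * (fourierCoeff f n * ((r : ℂ) * fourier 1 t) ^ n)
        = (fourierCoeff f n * (r : ℂ) ^ n) * (fourier (-m) t • fourier (n : ℤ) t) := by
      intro t
      rw [mul_pow, fourier_natCast, smul_eq_mul]; ring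
    simp_rw [h2]
    rw [integral_const_mul, h1]
    by_cases hnm : (n : ℤ) = m
    · subst hnm; simp
    · rw [if_neg hnm, Pi.single_eq_of_ne (Ne.symm hnm), mul_zero]
  have hs := hasSum_integral_of_summable_integral_norm (μ := arc)
    (F := fun (n : ℕ) (t : Torus) => fourier (-m) t * (fourierCoeff f n * (r * fourier 1 t) ^ n))
    (fun n => by
      have : Continuous fun t : Torus =>
          fourier (-m) t * (fourierCoeff f n * ((r : ℂ) * fourier 1 t) ^ n) := by
        have h1 := map_continuous (fourier (T := 2 * Real.pi) (-m))
        have h2 := map_continuous (fourier (T := 2 * Real.pi) 1)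
        fun_prop
      exact this.integrable_of_hasCompactSupport (HasCompactSupport.of_compactSpace _))
    (by
      have := summable_norm_fourierCoeff_mul_pow f hr'
      simpa only [norm_mul, norm_fourier_apply, norm_pow, one_mul, mul_one, integral_const,
        probReal_univ, one_smul] using this)
  simp_rw [hterm] at hs
  have hco : fourierCoeff (fun t : Torus => diskExt f (r * fourier 1 t)) m = ∫ t : Torus, ∑' n : ℕ,
      fourier (-m) t * (fourierCoeff f n * (r * fourier 1 t) ^ n) ∂arc := by
    simp only [fourierCoeff, diskExt, smul_eq_mul, tsum_mul_left]
  rw [hco, ← hs.tsum_eq]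
  split_ifs with hm
  · lift m to ℕ using hm
    rw [tsum_eq_single m fun n hn => by simp [hn]]
    simp
  · exact (tsum_congr fun n => if_neg (by omega)).trans tsum_zero

/-- By Parseval the squared `L²` distance is `∑ |f̂(n)|² (rⁿ - 1)²`, which tends to zero by
dominated convergence; the `L²` norm controls the `L¹` norm. -/
theorem tendsto_integral_norm_diskExt_radial_sub {f : Torus → ℂ} (hf : MemLp f 2 arc)
    (hf0 : ∀ n < 0, fourierCoeff f n = 0) :
    Tendsto (fun r : ℝ => ∫ t : Torus, ‖diskExt f (r * fourier 1 t) - f t‖ ∂arc) (𝓝[<] 1) (𝓝 0) := by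
  have hIoo : ∀ᶠ r : ℝ in 𝓝[<] 1, r ∈ Ioo (0 : ℝ) 1 := Ioo_mem_nhdsLT one_pos
  have hD : ∀ r ∈ Ioo (0 : ℝ) 1, MemLp (fun t : Torus => diskExt f (r * fourier 1 t) - f t) 2 arc :=
    fun r hr => ((continuous_diskExt_radial f hr.1.le hr.2).memLp_of_hasCompactSupport
      (HasCompactSupport.of_compactSpace _)).sub hf
  have hco : ∀ r ∈ Ioo (0 : ℝ) 1, ∀ n : ℤ,
      fourierCoeff (fun t : Torus => diskExt f (r * fourier 1 t) - f t) n =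
        fourierCoeff f n * ((r : ℂ) ^ n.toNat - 1) := by
    intro r hr n
    have h1 : fourierCoeff (fun t : Torus => diskExt f (r * fourier 1 t) - f t) n =
        fourierCoeff (fun t : Torus => diskExt f (r * fourier 1 t)) n - fourierCoeff f n := by
      simp only [fourierCoeff, smul_sub]
      refine integral_sub ?_ ?_
      · exact ((continuous_diskExt_radial f hr.1.le hr.2).integrable_of_hasCompactSupport
          (HasCompactSupport.of_compactSpace _)).fourier_smul _
      · exact (hf.integrable one_le_two).fourier_smul _
    rw [h1, fourierCoeff_diskExt_radial f hr.1.le hr.2]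
    split_ifs with hn
    · ring
    · rw [hf0 n (not_le.1 hn)]; simp
  have hsq : ∀ r ∈ Ioo (0 : ℝ) 1, ∫ t : Torus, ‖diskExt f (r * fourier 1 t) - f t‖ ^ 2 ∂arc =
      ∑' n : ℤ, ‖fourierCoeff f n * ((r : ℂ) ^ n.toNat - 1)‖ ^ 2 := by
    intro r hr
    have h1 := tsum_sq_fourierCoeff ((hD r hr).toLp _)
    rw [fourierCoeff_congr_ae (hD r hr).coeFn_toLp] at h1
    simp_rw [hco r hr] at h1
    rw [h1]
    refine integral_congr_ae ?_
    filter_upwards [(hD r hr).coeFn_toLp] with t ht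
    rw [ht]
  have hlim : Tendsto (fun r : ℝ => ∑' n : ℤ, ‖fourierCoeff f n * ((r : ℂ) ^ n.toNat - 1)‖ ^ 2)
      (𝓝[<] 1) (𝓝 (∑' n : ℤ, (0 : ℝ))) := by
    have hsum : Summable fun n : ℤ => ‖fourierCoeff f n‖ ^ 2 := by
      have h1 := (hasSum_sq_fourierCoeff (hf.toLp f)).summable
      rwa [fourierCoeff_congr_ae hf.coeFn_toLp] at h1
    refine tendsto_tsum_of_dominated_convergence hsum (fun n => ?_) ?_
    · have : Continuous fun r : ℝ => ‖fourierCoeff f n * ((r : ℂ) ^ n.toNat - 1)‖ ^ 2 := by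
        fun_prop
      have h2 := this.tendsto 1
      simp only [Complex.ofReal_one, one_pow, sub_self, mul_zero, norm_zero, ne_eq,
        OfNat.ofNat_ne_zero, not_false_eq_true, zero_pow] at h2
      exact h2.mono_left nhdsWithin_le_nhds
    · filter_upwards [hIoo] with r hr n
      rw [Real.norm_of_nonneg (by positivity), norm_mul]
      have h3 : ‖(r : ℂ) ^ n.toNat - 1‖ ≤ 1 := by
        rw [← Complex.ofReal_pow, ← Complex.ofReal_one, ← Complex.ofReal_sub, Complex.norm_real,
          Real.norm_eq_abs, abs_le]
        have h4 := pow_nonneg hr.1.le n.toNat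
        have h5 := pow_le_one₀ hr.1.le hr.2.le (n := n.toNat)
        constructor <;> linarith
      gcongr
      exact mul_le_of_le_one_right (norm_nonneg _) h3
  rw [tsum_zero] at hlim
  have hsqrt := (Real.continuous_sqrt.tendsto 0).comp hlim
  rw [Real.sqrt_zero] at hsqrt
  refine tendsto_of_tendsto_of_tendsto_of_le_of_le' tendsto_const_nhds hsqrt
    (Eventually.of_forall fun r => integral_nonneg fun t => norm_nonneg _) ?_
  filter_upwards [hIoo] with r hr
  rw [Function.comp_apply, ← hsq r hr]
  refine Real.le_sqrt_of_sq_le ?_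
  -- Nonnegativity of the variance is `(∫ X)² ≤ ∫ X²` on a probability space.
  have h1 := ProbabilityTheory.variance_eq_sub (hD r hr).norm
  have h2 := ProbabilityTheory.variance_nonneg
    (fun t : Torus => ‖diskExt f (r * fourier 1 t) - f t‖) arc
  rw [h1] at h2
  simpa using h2

/-! ### Weighted Jensen inequality for zero-free functions -/

/-- Take the primitive `L` of `F'/F` on the disc with `L(0) = log F(0)`; then `F exp(-L)` is
constant. -/
theorem exists_log_of_ne_zero {F : ℂ → ℂ} (hF : DifferentiableOn ℂ F (Metric.ball 0 1))
    (hF0 : ∀ z ∈ Metric.ball (0 : ℂ) 1, F z ≠ 0) :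
    ∃ L : ℂ → ℂ, DifferentiableOn ℂ L (Metric.ball 0 1) ∧
      (∀ z ∈ Metric.ball (0 : ℂ) 1, Complex.exp (L z) = F z) ∧
      deriv L 0 = deriv F 0 / F 0 := by
  have hd : DifferentiableOn ℂ (fun z => deriv F z / F z) (Metric.ball 0 1) :=
    (hF.deriv Metric.isOpen_ball).div hF hF0
  obtain ⟨L, hL0, hL⟩ := hd.isExactOn_ball.with_val_at 0 (Complex.log (F 0))
  have h0 : (0 : ℂ) ∈ Metric.ball (0 : ℂ) 1 := Metric.mem_ball_self one_pos
  refine ⟨L, fun z hz => (hL z hz).differentiableAt.differentiableWithinAt, fun z hz => ?_,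
    (hL 0 h0).deriv⟩
  have hder : ∀ w ∈ Metric.ball (0 : ℂ) 1,
      HasDerivAt (fun w => F w * Complex.exp (-L w)) 0 w := by
    intro w hw
    have h1 := (hF.differentiableAt (Metric.isOpen_ball.mem_nhds hw)).hasDerivAt
    have h2 := h1.mul (hL w hw).neg.cexp
    refine HasDerivAt.congr_deriv h2 ?_
    have := hF0 w hw
    simp only [Pi.neg_apply]
    field_simp
    ring
  have hc := Metric.isOpen_ball.is_const_of_deriv_eq_zero
    (convex_ball (0 : ℂ) 1).isPreconnected
    (fun w hw => (hder w hw).differentiableAt.differentiableWithinAt)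
    (fun w hw => (hder w hw).deriv) hz h0
  simp only [hL0] at hc
  rw [Complex.exp_neg, Complex.exp_neg, Complex.exp_log (hF0 0 h0),
    mul_inv_cancel₀ (hF0 0 h0)] at hc
  exact (eq_of_mul_inv_eq_one hc).symm

theorem integral_fourier_one_mul_of_differentiableOn {P : ℂ → ℂ} {s : ℝ} (hs : 1 < s)
    (hP : DifferentiableOn ℂ P (Metric.ball 0 s)) :
    ∫ t, P (fourier 1 t) ∂arc = P 0 ∧ ∫ t, fourier 1 t * P (fourier 1 t) ∂arc = 0 ∧
      ∫ t, conj (fourier 1 t) * P (fourier 1 t) ∂arc = deriv P 0 := by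
  have hav : ∀ Q : ℂ → ℂ, DifferentiableOn ℂ Q (Metric.ball 0 s) →
      ∫ t, Q (fourier 1 t) ∂arc = Q 0 := by
    intro Q hQ
    rw [← circleAverage_zero_one_eq_integral]
    refine DiffContOnCl.circleAverage (hQ.diffContOnCl_ball ?_)
    rw [abs_one]
    exact Metric.closedBall_subset_ball hs
  refine ⟨hav P hP, ?_, ?_⟩
  · have := hav (fun z => z * P z) (differentiableOn_id.mul hP)
    simpa only [zero_mul] using this
  -- On the circle `(P(z) - P(0))/z = z̄ (P(z) - P(0))`, so the mean value property of the slope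
  -- function yields `P'(0)`.
  · have hnhds : Metric.ball (0 : ℂ) s ∈ 𝓝 0 := Metric.ball_mem_nhds _ (by linarith)
    have h1 := hav (dslope P 0) ((Complex.differentiableOn_dslope hnhds).2 hP)
    rw [dslope_same] at h1
    have hz : ∫ t : Torus, conj (fourier 1 t) ∂arc = 0 := by
      rw [integral_conj]
      have := hav (fun z => z) differentiableOn_id
      rw [this, map_zero]
    have hPc : Continuous fun t : Torus => P (fourier 1 t) :=
      hP.continuousOn.comp_continuous (map_continuous (fourier (T := 2 * Real.pi) 1))
        fun t => mem_ball_zero_iff.2 (by rw [norm_fourier_apply]; exact hs)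
    have hcc : Continuous fun t : Torus => conj (fourier 1 t) :=
      Complex.continuous_conj.comp (map_continuous (fourier (T := 2 * Real.pi) 1))
    rw [← h1]
    have h2 : ∀ t : Torus, dslope P 0 (fourier 1 t) =
        conj (fourier 1 t) * P (fourier 1 t) - conj (fourier 1 t) * P 0 := by
      intro t
      rw [dslope_of_ne _ (fourier_one_ne_zero t), slope_def_field, sub_zero, ← mul_sub,
        div_eq_iff (fourier_one_ne_zero t), mul_right_comm, mul_comm (conj _),
        fourier_one_mul_conj, one_mul]
    simp_rw [h2]
    rw [integral_sub, integral_mul_const, hz, zero_mul, sub_zero]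
    · exact (hcc.mul hPc).integrable_of_hasCompactSupport (HasCompactSupport.of_compactSpace _)
    · exact (hcc.mul continuous_const).integrable_of_hasCompactSupport
        (HasCompactSupport.of_compactSpace _)

/-- `log|F|` is the real part of an analytic `L`, and the weight has frequencies `0, ±1` only, so
the integral sees just `L(0)` and `L'(0)`. -/
theorem integral_log_norm_radial {F : ℂ → ℂ} (hF : DifferentiableOn ℂ F (Metric.ball 0 1))
    (hF0 : ∀ z ∈ Metric.ball (0 : ℂ) 1, F z ≠ 0) (η : ℂ) {r : ℝ} (hr0 : 0 < r) (hr : r < 1) :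
    ∫ t : Torus, (1 + (η * fourier 1 t).re) * Real.log ‖F (r * fourier 1 t)‖ ∂arc =
      Real.log ‖F 0‖ + r / 2 * (conj η * (deriv F 0 / F 0)).re := by
  obtain ⟨L, hL, hexp, hder⟩ := exists_log_of_ne_zero hF hF0
  have h0 : (0 : ℂ) ∈ Metric.ball (0 : ℂ) 1 := Metric.mem_ball_self one_pos
  have hlog : ∀ z ∈ Metric.ball (0 : ℂ) 1, Real.log ‖F z‖ = (L z).re := by
    intro z hz
    rw [← hexp z hz, Complex.norm_exp, Real.log_exp]
  have hP : DifferentiableOn ℂ (fun w => L (r * w)) (Metric.ball 0 r⁻¹) := by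
    refine hL.comp (by fun_prop) fun w hw => ?_
    rw [mem_ball_zero_iff] at hw ⊢
    rw [norm_mul, Complex.norm_real, Real.norm_of_nonneg hr0.le]
    rwa [← lt_inv_mul_iff₀ hr0, mul_one]
  obtain ⟨h1, h2, h3⟩ := integral_fourier_one_mul_of_differentiableOn
    ((one_lt_inv₀ hr0).2 hr) hP
  have hPd : deriv (fun w => L (r * w)) 0 = r * (deriv F 0 / F 0) := by
    have := deriv_comp_mul_left (r : ℂ) L 0
    rw [this, mul_zero, hder, smul_eq_mul]
  rw [hPd] at h3
  simp only [mul_zero] at h1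
  have hPc : Continuous fun t : Torus => L (r * fourier 1 t) :=
    hL.continuousOn.comp_continuous
      (continuous_const.mul (map_continuous (fourier (T := 2 * Real.pi) 1)))
      fun t => by simpa using norm_ofReal_mul_fourier_lt_one hr0.le hr t
  have hzc : Continuous fun t : Torus => fourier 1 t :=
    map_continuous (fourier (T := 2 * Real.pi) 1)
  have hcc : Continuous fun t : Torus => conj (fourier 1 t) :=
    Complex.continuous_conj.comp hzc
  have hint : ∀ g : Torus → ℂ, Continuous g → Integrable g arc := fun g hg =>
    hg.integrable_of_hasCompactSupport (HasCompactSupport.of_compactSpace _)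
  have hpt : ∀ t : Torus, (1 + (η * fourier 1 t).re) * Real.log ‖F (r * fourier 1 t)‖ =
      (L (r * fourier 1 t) + (η / 2 * (fourier 1 t * L (r * fourier 1 t)) +
        conj η / 2 * (conj (fourier 1 t) * L (r * fourier 1 t)))).re := by
    intro t
    rw [hlog _ (by simpa using norm_ofReal_mul_fourier_lt_one hr0.le hr t)]
    have h4 : L (r * fourier 1 t) + (η / 2 * (fourier 1 t * L (r * fourier 1 t)) +
        conj η / 2 * (conj (fourier 1 t) * L (r * fourier 1 t))) =
        (((1 + (η * fourier 1 t).re : ℝ)) : ℂ) * L (r * fourier 1 t) := by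
      push_cast
      rw [Complex.re_eq_add_conj, map_mul]
      ring
    rw [h4, Complex.re_ofReal_mul]
  simp_rw [hpt]
  have i1 := hint _ hPc
  have i2 : Integrable (fun t : Torus => η / 2 * (fourier 1 t * L (r * fourier 1 t))) arc :=
    hint _ (continuous_const.mul (hzc.mul hPc))
  have i3 : Integrable (fun t : Torus =>
      conj η / 2 * (conj (fourier 1 t) * L (r * fourier 1 t))) arc :=
    hint _ (continuous_const.mul (hcc.mul hPc))
  have i23 : Integrable (fun t : Torus => η / 2 * (fourier 1 t * L (r * fourier 1 t)) +
      conj η / 2 * (conj (fourier 1 t) * L (r * fourier 1 t))) arc := i2.add i3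
  have hre := integral_re (𝕜 := ℂ) (i1.add i23)
  simp only [Pi.add_apply, RCLike.re_eq_complex_re] at hre
  rw [hre, integral_add i1 i23, integral_add i2 i3, integral_const_mul, integral_const_mul, h1, h2, h3,
    hlog 0 h0, mul_zero, zero_add, Complex.add_re]
  congr 1
  rw [← Complex.re_ofReal_mul]
  push_cast
  congr 1
  ring

theorem abs_log_norm_add_le {x ε : ℝ} (hx : 0 ≤ x) (hε : 0 < ε) :
    |Real.log (x + ε)| ≤ x + ε + |Real.log ε| := by
  have h1 : Real.log ε ≤ Real.log (x + ε) := Real.log_le_log hε (by linarith)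
  have h2 : Real.log (x + ε) ≤ x + ε - 1 := Real.log_le_sub_one_of_pos (by linarith)
  rw [abs_le]
  constructor
  · linarith [neg_abs_le (Real.log ε)]
  · linarith [abs_nonneg (Real.log ε)]

theorem weight_nonneg {η : ℂ} (hη : ‖η‖ ≤ 1) (t : Torus) :
    0 ≤ 1 + (η * fourier 1 t).re ∧ 1 + (η * fourier 1 t).re ≤ 2 := by
  have h : |(η * fourier 1 t).re| ≤ 1 := by
    refine (Complex.abs_re_le_norm _).trans ?_
    rwa [norm_mul, norm_fourier_apply, mul_one]
  rw [abs_le] at h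
  constructor <;> linarith [h.1, h.2]

theorem continuous_weight (η : ℂ) : Continuous fun t : Torus => 1 + (η * fourier 1 t).re :=
  continuous_const.add (Complex.continuous_re.comp
    (continuous_const.mul (map_continuous (fourier (T := 2 * Real.pi) 1))))

theorem integrable_weight_mul {η : ℂ} (hη : ‖η‖ ≤ 1) {u : Torus → ℝ} (hu : Integrable u arc) :
    Integrable (fun t => (1 + (η * fourier 1 t).re) * u t) arc := by
  refine hu.bdd_mul (c := 2) (continuous_weight η).aestronglyMeasurable (ae_of_all _ fun t => ?_)
  rw [Real.norm_of_nonneg (weight_nonneg hη t).1]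
  exact (weight_nonneg hη t).2

/-- The identity at radius `r < 1` is passed to the boundary. Adding `ε` inside the logarithm makes
it `1/ε`-Lipschitz, so the error is at most `2/ε` times an `L¹` distance that vanishes as `r → 1`;
then `ε → 0`. Only an inequality survives: a singular inner factor can make it strict. -/
theorem log_coeff_le_integral_weight_mul_log_norm {f : Torus → ℂ} (hf : MemLp f 2 arc)
    (hf0 : ∀ n < 0, fourierCoeff f n = 0) (hz : ∀ z ∈ Metric.ball (0 : ℂ) 1, diskExt f z ≠ 0)
    (hlog : Integrable (fun t => Real.log ‖f t‖) arc) (hne : ∀ᵐ t ∂arc, f t ≠ 0)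
    {η : ℂ} (hη : ‖η‖ ≤ 1) :
    Real.log ‖fourierCoeff f 0‖ + 1 / 2 * (conj η * (fourierCoeff f 1 / fourierCoeff f 0)).re ≤
      ∫ t, (1 + (η * fourier 1 t).re) * Real.log ‖f t‖ ∂arc := by
  have hfi : Integrable f arc := hf.integrable one_le_two
  have hlogm : ∀ ε : ℝ, AEStronglyMeasurable (fun t => Real.log (‖f t‖ + ε)) arc := fun ε =>
    (Real.measurable_log.comp_aemeasurable (hf.1.norm.aemeasurable.add_const ε)).aestronglyMeasurable
  have hstep : ∀ ε : ℝ, 0 < ε →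
      Real.log ‖fourierCoeff f 0‖ +
        1 / 2 * (conj η * (fourierCoeff f 1 / fourierCoeff f 0)).re ≤
      ∫ t, (1 + (η * fourier 1 t).re) * Real.log (‖f t‖ + ε) ∂arc := by
    intro ε hε
    have hli : Integrable (fun t => Real.log (‖f t‖ + ε)) arc := by
      refine Integrable.mono' ((hfi.norm.add (integrable_const (ε + |Real.log ε|)))) (hlogm ε)
        (ae_of_all _ fun t => ?_)
      have := abs_log_norm_add_le (norm_nonneg (f t)) hε
      rw [Real.norm_eq_abs]
      simpa [add_assoc] using this
    have hlim := (tendsto_integral_norm_diskExt_radial_sub hf hf0).const_mul (2 / ε)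
    rw [mul_zero] at hlim
    have hlim2 := hlim.const_add (∫ t, (1 + (η * fourier 1 t).re) * Real.log (‖f t‖ + ε) ∂arc)
    rw [add_zero] at hlim2
    have hlim1 : Tendsto (fun r : ℝ => Real.log ‖fourierCoeff f 0‖ +
        r / 2 * (conj η * (fourierCoeff f 1 / fourierCoeff f 0)).re) (𝓝[<] 1)
        (𝓝 (Real.log ‖fourierCoeff f 0‖ +
          1 / 2 * (conj η * (fourierCoeff f 1 / fourierCoeff f 0)).re)) := by
      have : Continuous fun r : ℝ => Real.log ‖fourierCoeff f 0‖ +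
        r / 2 * (conj η * (fourierCoeff f 1 / fourierCoeff f 0)).re := by fun_prop
      exact (this.tendsto 1).mono_left nhdsWithin_le_nhds
    refine le_of_tendsto_of_tendsto hlim1 hlim2 ?_
    filter_upwards [Ioo_mem_nhdsLT (zero_lt_one (α := ℝ))] with r hr
    have hmv := integral_log_norm_radial (differentiableOn_diskExt f) hz η hr.1 hr.2
    rw [deriv_diskExt_zero, diskExt_zero] at hmv
    rw [← hmv, ← integral_const_mul]
    have hFc := continuous_diskExt_radial f hr.1.le hr.2
    have hFi : Integrable (fun t : Torus => diskExt f (r * fourier 1 t)) arc :=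
      hFc.integrable_of_hasCompactSupport (HasCompactSupport.of_compactSpace _)
    have hF0 : ∀ t : Torus, diskExt f (r * fourier 1 t) ≠ 0 := fun t =>
      hz _ (by simpa using norm_ofReal_mul_fourier_lt_one hr.1.le hr.2 t)
    have hw := integrable_weight_mul hη hli
    have hd : Integrable (fun t : Torus => 2 / ε * ‖diskExt f (r * fourier 1 t) - f t‖) arc :=
      (hFi.sub hfi).norm.const_mul _
    rw [← integral_add hw hd]
    refine integral_mono ?_ (hw.add hd) fun t => ?_
    · refine ((continuous_weight η).mul (hFc.norm.log fun t => ?_)).integrable_of_hasCompactSupport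
        (HasCompactSupport.of_compactSpace _)
      exact norm_ne_zero_iff.2 (hF0 t)
    · set d := ‖diskExt f (r * fourier 1 t) - f t‖ with hd
      have hx : 0 < ‖f t‖ + ε := by positivity
      have hd0 : 0 ≤ d := norm_nonneg _
      have h1 : Real.log ‖diskExt f (r * fourier 1 t)‖ ≤ Real.log (‖f t‖ + ε) + d / ε := by
        have h2 : ‖diskExt f (r * fourier 1 t)‖ ≤ (‖f t‖ + ε) + d := by
          have := norm_sub_norm_le (diskExt f (r * fourier 1 t)) (f t)
          linarith
        have h3 : Real.log ((‖f t‖ + ε) + d) - Real.log (‖f t‖ + ε) ≤ d / ε := by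
          rw [← Real.log_div (by positivity) hx.ne']
          refine (Real.log_le_sub_one_of_pos (by positivity)).trans ?_
          rw [add_div, div_self hx.ne', add_sub_cancel_left]
          exact div_le_div_of_nonneg_left hd0 hε (by linarith [norm_nonneg (f t)])
        have h4 := Real.log_le_log (norm_pos_iff.2 (hF0 t)) h2
        linarith
      obtain ⟨hw0, hw2⟩ := weight_nonneg hη t
      calc (1 + (η * fourier 1 t).re) * Real.log ‖diskExt f (r * fourier 1 t)‖
          ≤ (1 + (η * fourier 1 t).re) * (Real.log (‖f t‖ + ε) + d / ε) := by gcongr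
        _ ≤ (1 + (η * fourier 1 t).re) * Real.log (‖f t‖ + ε) + 2 / ε * d := by
          rw [mul_add]
          have : (1 + (η * fourier 1 t).re) * (d / ε) ≤ 2 * (d / ε) := by gcongr
          have h5 : 2 * (d / ε) = 2 / ε * d := by ring
          linarith
  have hlim : Tendsto (fun ε : ℝ => ∫ t, (1 + (η * fourier 1 t).re) * Real.log (‖f t‖ + ε) ∂arc)
      (𝓝[>] 0) (𝓝 (∫ t, (1 + (η * fourier 1 t).re) * Real.log ‖f t‖ ∂arc)) := by
    -- For `ε < 1`, `log‖f‖ ≤ log(‖f‖ + ε) ≤ ‖f‖`; the factor `2` bounds the weight.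
    refine tendsto_integral_filter_of_dominated_convergence
      (fun t => 2 * (|Real.log ‖f t‖| + ‖f t‖)) ?_ ?_ ((hlog.abs.add hfi.norm).const_mul 2) ?_
    · exact Eventually.of_forall fun ε =>
        (continuous_weight η).aestronglyMeasurable.mul (hlogm ε)
    · filter_upwards [Ioo_mem_nhdsGT (zero_lt_one (α := ℝ))] with ε hε
      filter_upwards [hne] with t ht
      obtain ⟨hw0, hw2⟩ := weight_nonneg hη t
      have hft := norm_pos_iff.2 ht
      rw [norm_mul, Real.norm_of_nonneg hw0, Real.norm_eq_abs]
      have h1 : Real.log ‖f t‖ ≤ Real.log (‖f t‖ + ε) := Real.log_le_log hft (by linarith [hε.1])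
      have h2 : Real.log (‖f t‖ + ε) ≤ ‖f t‖ + ε - 1 :=
        Real.log_le_sub_one_of_pos (by linarith [hε.1])
      have h3 : |Real.log (‖f t‖ + ε)| ≤ |Real.log ‖f t‖| + ‖f t‖ := by
        rw [abs_le]
        constructor
        · linarith [neg_abs_le (Real.log ‖f t‖)]
        · linarith [abs_nonneg (Real.log ‖f t‖), hε.2]
      gcongr
    · filter_upwards [hne] with t ht
      have hc : ContinuousAt (fun ε : ℝ => (1 + (η * fourier 1 t).re) * Real.log (‖f t‖ + ε)) 0 :=
        continuousAt_const.mul ((continuousAt_const.add continuousAt_id).log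
          (by simpa using ht))
      have h1 := hc.tendsto
      simp only [add_zero] at h1
      exact h1.mono_left nhdsWithin_le_nhds
  exact ge_of_tendsto hlim (by filter_upwards [self_mem_nhdsWithin] with ε hε using hstep ε hε)

/-! ### The weight `a z + (a z)^*` -/

theorem integral_add_pi {E : Type*} [NormedAddCommGroup E] [NormedSpace ℝ E] (g : Torus → E) :
    ∫ t, g (t + ((Real.pi : ℝ) : Torus)) ∂arc = ∫ t, g t ∂arc :=
  integral_add_right_eq_self g _

theorem integral_eq_zero_of_antiperiodic_pi {g : Torus → ℂ}
    (hg : ∀ t, g (t + ((Real.pi : ℝ) : Torus)) = -g t) : ∫ t, g t ∂arc = 0 := by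
  have h := integral_add_pi g
  simp_rw [hg] at h
  rw [integral_neg] at h
  exact self_eq_neg.1 h.symm

theorem neilWeight_add_pi (a : ℂ) (t : Torus) :
    neilWeight a (t + ((Real.pi : ℝ) : Torus)) = -neilWeight a t := by
  rw [neilWeight, neilWeight, fourier_one_add_pi, mul_neg, Complex.neg_re, mul_neg]

theorem fourier_one_mul_neilWeight (a : ℂ) (t : Torus) :
    fourier 1 t * (neilWeight a t : ℂ) = conj a + a * fourier 1 t ^ 2 := by
  rw [neilWeight, Complex.ofReal_mul, Complex.re_eq_add_conj, map_mul]
  push_cast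
  linear_combination (conj a) * fourier_one_mul_conj t

theorem abs_neilWeight_eq_norm (a : ℂ) (t : Torus) :
    |neilWeight a t| = ‖conj a + a * fourier 1 t ^ 2‖ := by
  rw [← fourier_one_mul_neilWeight, norm_mul, norm_fourier_apply, one_mul, Complex.norm_real,
    Real.norm_eq_abs]

theorem exists_abs_neilWeight_eq {a : ℂ} (ha : a ≠ 0) :
    ∃ b : ℂ, ‖b‖ = 1 ∧
      ∀ t, |neilWeight a t| = ‖a‖ * (‖fourier 1 t - b‖ * ‖fourier 1 t - -b‖) := by
  -- `±b` are the roots of `ā + a z²`.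
  obtain ⟨b, hb⟩ := IsAlgClosed.exists_pow_nat_eq (-(conj a / a)) two_pos
  refine ⟨b, ?_, fun t => ?_⟩
  · have h := congrArg norm hb
    rw [norm_pow, norm_neg, norm_div, Complex.norm_conj, div_self (norm_ne_zero_iff.2 ha)] at h
    exact (pow_eq_one_iff_of_nonneg (norm_nonneg _) two_ne_zero).1 h
  · rw [abs_neilWeight_eq_norm, ← norm_mul, ← norm_mul]
    congr 1
    have : a * b ^ 2 = -conj a := by rw [hb]; field_simp
    linear_combination this

theorem ae_neilWeight_ne_zero {a : ℂ} (ha : a ≠ 0) : ∀ᵐ t ∂arc, neilWeight a t ≠ 0 := by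
  obtain ⟨b, -, hb⟩ := exists_abs_neilWeight_eq ha
  filter_upwards [ae_fourier_one_ne b, ae_fourier_one_ne (-b)] with t h1 h2
  rw [← abs_ne_zero, hb]
  exact mul_ne_zero (norm_ne_zero_iff.2 ha)
    (mul_ne_zero (norm_ne_zero_iff.2 (sub_ne_zero.2 h1)) (norm_ne_zero_iff.2 (sub_ne_zero.2 h2)))

theorem integrable_log_norm_fourier_one_sub (b : ℂ) :
    Integrable (fun t : Torus => Real.log ‖fourier 1 t - b‖) arc :=
  integrable_of_circleIntegrable (f := fun z : ℂ => Real.log ‖z - b‖)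
    (by fun_prop : Measurable fun z : ℂ => Real.log ‖z - b‖).stronglyMeasurable
    (circleIntegrable_log_norm_sub_const 1)

theorem log_abs_neilWeight_ae_eq {a : ℂ} (ha : a ≠ 0) :
    ∃ b : ℂ, ‖b‖ = 1 ∧ (fun t => Real.log |neilWeight a t|) =ᵐ[arc] fun t =>
      Real.log ‖a‖ + (Real.log ‖fourier 1 t - b‖ + Real.log ‖fourier 1 t - -b‖) := by
  obtain ⟨b, hb1, hb⟩ := exists_abs_neilWeight_eq ha
  refine ⟨b, hb1, ?_⟩
  filter_upwards [ae_fourier_one_ne b, ae_fourier_one_ne (-b)] with t h1 h2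
  have h1' := norm_ne_zero_iff.2 (sub_ne_zero.2 h1)
  have h2' := norm_ne_zero_iff.2 (sub_ne_zero.2 h2)
  rw [hb, Real.log_mul (norm_ne_zero_iff.2 ha) (mul_ne_zero h1' h2'), Real.log_mul h1' h2']

theorem integrable_log_abs_neilWeight {a : ℂ} (ha : a ≠ 0) :
    Integrable (fun t => Real.log |neilWeight a t|) arc := by
  obtain ⟨b, -, hb⟩ := log_abs_neilWeight_ae_eq ha
  exact (((integrable_const _).add ((integrable_log_norm_fourier_one_sub b).add
    (integrable_log_norm_fourier_one_sub (-b)))).congr hb.symm)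

theorem integral_log_abs_neilWeight {a : ℂ} (ha : a ≠ 0) :
    ∫ t, Real.log |neilWeight a t| ∂arc = Real.log ‖a‖ := by
  obtain ⟨b, hb1, hb⟩ := log_abs_neilWeight_ae_eq ha
  have h0 : ∀ b : ℂ, ‖b‖ = 1 → ∫ t : Torus, Real.log ‖fourier 1 t - b‖ ∂arc = 0 := by
    intro b hb
    rw [← circleAverage_zero_one_eq_integral fun z : ℂ => Real.log ‖z - b‖]
    exact circleAverage_log_norm_sub_const₁ hb
  have i1 := integrable_log_norm_fourier_one_sub b
  have i2 := integrable_log_norm_fourier_one_sub (-b)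
  have i12 : Integrable (fun t : Torus => Real.log ‖fourier 1 t - b‖ +
    Real.log ‖fourier 1 t - -b‖) arc := i1.add i2
  rw [integral_congr_ae hb, integral_add (integrable_const _) i12, integral_add i1 i2, h0 b hb1,
    h0 (-b) (by rwa [norm_neg])]
  simp

/-- Rotation by `π` preserves `|neilWeight a|` and replaces `η` by `-η`, so averaging the two
integrals removes the `η` term. -/
theorem integral_weight_mul_log_abs_neilWeight {a : ℂ} (ha : a ≠ 0) {η : ℂ} (hη : ‖η‖ ≤ 1) :
    ∫ t, (1 + (η * fourier 1 t).re) * Real.log |neilWeight a t| ∂arc = Real.log ‖a‖ := by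
  have hi := integrable_log_abs_neilWeight ha
  have hw := integrable_weight_mul hη hi
  have h := integral_add_pi fun t => (1 + (η * fourier 1 t).re) * Real.log |neilWeight a t|
  simp only [neilWeight_add_pi, abs_neg, fourier_one_add_pi, mul_neg, Complex.neg_re] at h
  have hw' := integrable_weight_mul (η := -η) (by rwa [norm_neg]) hi
  simp only [neg_mul, Complex.neg_re] at hw'
  have hsum := integral_add hw hw'
  have h2 : ∀ t, (1 + (η * fourier 1 t).re) * Real.log |neilWeight a t| +
      (1 + -(η * fourier 1 t).re) * Real.log |neilWeight a t| =
      2 * Real.log |neilWeight a t| := fun t => by ring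
  simp_rw [h2] at hsum
  rw [integral_const_mul, integral_log_abs_neilWeight ha] at hsum
  linarith

theorem integral_conj_mul_log_abs_neilWeight (a : ℂ) :
    ∫ t, conj (fourier 1 t) * (Real.log |neilWeight a t| : ℂ) ∂arc = 0 := by
  refine integral_eq_zero_of_antiperiodic_pi fun t => ?_
  rw [neilWeight_add_pi, abs_neg, fourier_one_add_pi, map_neg, neg_mul]

/-! ### Factors of the weight -/

theorem diskExt_eq_of_ae_eq {h : Torus → ℂ} {a : ℂ}
    (hh : ∀ᵐ t ∂arc, h t = conj a + a * fourier 1 t ^ 2) (z : ℂ) :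
    diskExt h z = conj a + a * z ^ 2 := by
  have hco : ∀ n : ℕ, fourierCoeff h n = if n = 0 then conj a else if n = 2 then a else 0 := by
    intro n
    have h1 : h =ᵐ[arc] fun t => (fun t : Torus => conj a * fourier 0 t) t +
        (fun t : Torus => a * fourier 2 t) t := by
      filter_upwards [hh] with t ht
      have h2 := fourier_natCast 2 t
      rw [Nat.cast_ofNat] at h2
      simp only [ht, fourier_zero, mul_one, h2]
    have hi : ∀ (b : ℂ) (k : ℤ), Integrable (fun t : Torus => b * fourier k t) arc := fun b k =>
      (continuous_const.mul (map_continuous (fourier (T := 2 * Real.pi) k))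
        ).integrable_of_hasCompactSupport (HasCompactSupport.of_compactSpace _)
    have h3 := congrFun (fourierCoeff.add (hi (conj a) 0) (hi a 2)) n
    rw [fourierCoeff_congr_ae h1]
    refine h3.trans ?_
    rw [Pi.add_apply, fourierCoeff.const_mul, fourierCoeff.const_mul, fourierCoeff_fourier,
      fourierCoeff_fourier]
    rcases n with _ | _ | _ | n
    · simp
    · simp
    · simp
    · have e1 : ((n + 1 + 1 + 1 : ℕ) : ℤ) ≠ 0 := by omega
      have e2 : ((n + 1 + 1 + 1 : ℕ) : ℤ) ≠ 2 := by omega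
      rw [Pi.single_eq_of_ne e1, Pi.single_eq_of_ne e2]
      simp
  rw [diskExt, tsum_eq_sum (s := {0, 2}) fun n hn => ?_]
  · rw [Finset.sum_pair (by norm_num), hco, hco]
    simp
  · rw [Finset.mem_insert, Finset.mem_singleton, not_or] at hn
    rw [hco, if_neg hn.1, if_neg hn.2, zero_mul]

/-- A zero of `ā + a z²` satisfies `|z|² = 1`. -/
theorem diskExt_ne_zero_of_mul_ae_eq {f g : Torus → ℂ} (hf : MemLp f 2 arc) (hg : MemLp g 2 arc)
    (hf0 : ∀ n < 0, fourierCoeff f n = 0) (hg0 : ∀ n < 0, fourierCoeff g n = 0) {a : ℂ}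
    (ha : a ≠ 0) (hfg : ∀ᵐ t ∂arc, f t * g t = conj a + a * fourier 1 t ^ 2) {z : ℂ}
    (hz : z ∈ Metric.ball (0 : ℂ) 1) : diskExt f z * diskExt g z ≠ 0 := by
  rw [mem_ball_zero_iff] at hz
  rw [diskExt_mul hf hg hf0 hg0 hz, diskExt_eq_of_ae_eq hfg]
  intro h
  have h1 : ‖a‖ = ‖a‖ * ‖z‖ ^ 2 := by
    rw [← norm_pow, ← norm_mul, ← Complex.norm_conj a, eq_neg_of_add_eq_zero_left h, norm_neg,
      norm_mul]
  have h2 : ‖z‖ ^ 2 < 1 := pow_lt_one₀ (norm_nonneg _) hz two_ne_zero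
  nlinarith [norm_pos_iff.2 ha]

/-- The upper bound is `log x ≤ x - 1`. The lower bound uses the cofactor: `log|f| = log|fg| -
log|g|`, with `log|g|` bounded above in the same way. -/
theorem integrable_log_norm_of_mul_ae_eq {f g : Torus → ℂ} (hf : MemLp f 2 arc)
    (hg : MemLp g 2 arc) {a : ℂ} (ha : a ≠ 0)
    (hfg : ∀ᵐ t ∂arc, f t * g t = conj a + a * fourier 1 t ^ 2) :
    Integrable (fun t => Real.log ‖f t‖) arc := by
  have hfi := hf.integrable one_le_two
  have hgi := hg.integrable one_le_two
  refine Integrable.mono' ((hfi.norm.add hgi.norm).add (integrable_log_abs_neilWeight ha).abs)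
    (Real.measurable_log.comp_aemeasurable hf.1.norm.aemeasurable).aestronglyMeasurable ?_
  filter_upwards [hfg, ae_neilWeight_ne_zero ha] with t ht hk
  have habs : |neilWeight a t| = ‖f t‖ * ‖g t‖ := by
    rw [abs_neilWeight_eq_norm, ← ht, norm_mul]
  have hne : ‖f t‖ * ‖g t‖ ≠ 0 := by rw [← habs]; exact abs_ne_zero.2 hk
  have hf' : 0 < ‖f t‖ := (norm_nonneg _).lt_of_ne (left_ne_zero_of_mul hne).symm
  have hg' : 0 < ‖g t‖ := (norm_nonneg _).lt_of_ne (right_ne_zero_of_mul hne).symm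
  have h1 := Real.log_le_sub_one_of_pos hf'
  have h2 := Real.log_le_sub_one_of_pos hg'
  have h3 := Real.log_mul hf'.ne' hg'.ne'
  simp only [Pi.add_apply]
  rw [Real.norm_eq_abs, habs, abs_le]
  have h4 := neg_abs_le (Real.log (‖f t‖ * ‖g t‖))
  have h5 := abs_nonneg (Real.log (‖f t‖ * ‖g t‖))
  constructor <;> linarith

/-- The product has constant term `ā` and no linear term, so `g'(0)/g(0) = -f'(0)/f(0)`. The Jensen
inequalities for `f` and `g` therefore add up to `log|a| ≤ log|a|`, and neither can be strict. -/
theorem log_coeff_eq_integral_weight_mul_log_norm {f g : Torus → ℂ} (hf : MemLp f 2 arc)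
    (hg : MemLp g 2 arc) (hf0 : ∀ n < 0, fourierCoeff f n = 0)
    (hg0 : ∀ n < 0, fourierCoeff g n = 0) {a : ℂ} (ha : a ≠ 0)
    (hfg : ∀ᵐ t ∂arc, f t * g t = conj a + a * fourier 1 t ^ 2) {η : ℂ} (hη : ‖η‖ ≤ 1) :
    Real.log ‖fourierCoeff f 0‖ + 1 / 2 * (conj η * (fourierCoeff f 1 / fourierCoeff f 0)).re =
      ∫ t, (1 + (η * fourier 1 t).re) * Real.log ‖f t‖ ∂arc := by
  have hgf : ∀ᵐ t ∂arc, g t * f t = conj a + a * fourier 1 t ^ 2 := by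
    simpa only [mul_comm] using hfg
  have hz : ∀ z ∈ Metric.ball (0 : ℂ) 1, diskExt f z * diskExt g z ≠ 0 := fun z hz =>
    diskExt_ne_zero_of_mul_ae_eq hf hg hf0 hg0 ha hfg hz
  have hlf := integrable_log_norm_of_mul_ae_eq hf hg ha hfg
  have hlg := integrable_log_norm_of_mul_ae_eq hg hf ha hgf
  have hne : ∀ᵐ t ∂arc, f t ≠ 0 ∧ g t ≠ 0 := by
    filter_upwards [hfg, ae_neilWeight_ne_zero ha] with t ht hk
    rw [← mul_ne_zero_iff, ht, ← norm_ne_zero_iff, ← abs_neilWeight_eq_norm]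
    exact abs_ne_zero.2 hk
  refine le_antisymm (log_coeff_le_integral_weight_mul_log_norm hf hf0
    (fun z h => left_ne_zero_of_mul (hz z h)) hlf (hne.mono fun t h => h.1) hη) ?_
  have hG := log_coeff_le_integral_weight_mul_log_norm hg hg0
    (fun z h => right_ne_zero_of_mul (hz z h)) hlg (hne.mono fun t h => h.2) hη
  have hsum : ∫ t, (1 + (η * fourier 1 t).re) * Real.log ‖f t‖ ∂arc +
      ∫ t, (1 + (η * fourier 1 t).re) * Real.log ‖g t‖ ∂arc = Real.log ‖a‖ := by
    rw [← integral_add (integrable_weight_mul hη hlf) (integrable_weight_mul hη hlg),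
      ← integral_weight_mul_log_abs_neilWeight ha hη]
    refine integral_congr_ae ?_
    filter_upwards [hfg, hne] with t ht h0
    rw [abs_neilWeight_eq_norm, ← ht, norm_mul,
      Real.log_mul (norm_ne_zero_iff.2 h0.1) (norm_ne_zero_iff.2 h0.2), mul_add]
  have hprod : ∀ n : ℕ, fourierCoeff (fun t => f t * g t) n =
      ∑ p ∈ Finset.HasAntidiagonal.antidiagonal n, fourierCoeff f p.1 * fourierCoeff g p.2 :=
    fourierCoeff_mul_of_nonneg hf hg hf0 hg0
  have hE : diskExt (fun t => f t * g t) = fun z => conj a + a * z ^ 2 :=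
    funext fun z => diskExt_eq_of_ae_eq hfg z
  have hp0 : fourierCoeff f 0 * fourierCoeff g 0 = conj a := by
    have h1 := hprod 0
    have h2 := diskExt_zero fun t => f t * g t
    rw [hE] at h2
    simp only [Nat.cast_zero, Finset.Nat.antidiagonal_zero, Finset.sum_singleton] at h1
    rw [← h1, ← h2]
    simp
  have hp1 : fourierCoeff f 0 * fourierCoeff g 1 + fourierCoeff f 1 * fourierCoeff g 0 = 0 := by
    have h1 := hprod 1
    have h2 := deriv_diskExt_zero fun t => f t * g t
    rw [hE] at h2
    rw [Finset.Nat.sum_antidiagonal_eq_sum_range_succ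
      (fun i j : ℕ => fourierCoeff f i * fourierCoeff g j)] at h1
    simp only [Finset.sum_range_succ, Finset.sum_range_zero] at h1
    simp only [Nat.cast_zero, Nat.cast_one, tsub_zero, tsub_self, zero_add] at h1
    rw [← h1, ← h2]
    simp
  have hne0 : fourierCoeff f 0 * fourierCoeff g 0 ≠ 0 := by
    rw [hp0]; simpa using ha
  have hf00 := left_ne_zero_of_mul hne0
  have hg00 := right_ne_zero_of_mul hne0
  have hlog : Real.log ‖fourierCoeff f 0‖ + Real.log ‖fourierCoeff g 0‖ = Real.log ‖a‖ := by
    rw [← Real.log_mul (norm_ne_zero_iff.2 hf00) (norm_ne_zero_iff.2 hg00), ← norm_mul, hp0,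
      Complex.norm_conj]
  have hratio : fourierCoeff g 1 / fourierCoeff g 0 =
      -(fourierCoeff f 1 / fourierCoeff f 0) := by
    field_simp
    linear_combination hp1
  rw [hratio, mul_neg, Complex.neg_re] at hG
  linarith

theorem coeff_ratio_eq_integral_log_norm {f g : Torus → ℂ} (hf : MemLp f 2 arc)
    (hg : MemLp g 2 arc) (hf0 : ∀ n < 0, fourierCoeff f n = 0)
    (hg0 : ∀ n < 0, fourierCoeff g n = 0) {a : ℂ} (ha : a ≠ 0)
    (hfg : ∀ᵐ t ∂arc, f t * g t = conj a + a * fourier 1 t ^ 2) :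
    fourierCoeff f 1 / fourierCoeff f 0 =
      2 * ∫ t, conj (fourier 1 t) * (Real.log ‖f t‖ : ℂ) ∂arc := by
  have hl := integrable_log_norm_of_mul_ae_eq hf hg ha hfg
  have key : ∀ η : ℂ, ‖η‖ ≤ 1 → 1 / 2 * (conj η * (fourierCoeff f 1 / fourierCoeff f 0)).re =
      ∫ t, (η * fourier 1 t).re * Real.log ‖f t‖ ∂arc := by
    intro η hη
    have h1 := log_coeff_eq_integral_weight_mul_log_norm hf hg hf0 hg0 ha hfg hη
    have h0 := log_coeff_eq_integral_weight_mul_log_norm hf hg hf0 hg0 ha hfg (η := 0)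
      (by simp)
    have i1 := integrable_weight_mul hη hl
    have i0 := integrable_weight_mul (η := 0) (by simp) hl
    have h2 := integral_sub i1 i0
    rw [← h1, ← h0] at h2
    have h3 : ∀ t, (1 + (η * fourier 1 t).re) * Real.log ‖f t‖ -
        (1 + (0 * fourier 1 t).re) * Real.log ‖f t‖ =
        (η * fourier 1 t).re * Real.log ‖f t‖ := by
      intro t
      rw [zero_mul, Complex.zero_re]; ring
    simp_rw [h3] at h2
    rw [h2]
    simp
  have hi : Integrable (fun t => conj (fourier 1 t) * (Real.log ‖f t‖ : ℂ)) arc := by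
    refine hl.ofReal.bdd_mul (c := 1) (Complex.continuous_conj.comp
      (map_continuous (fourier (T := 2 * Real.pi) 1))).aestronglyMeasurable (ae_of_all _ fun t => ?_)
    rw [Complex.norm_conj, norm_fourier_apply]
  -- `η = 1` gives the real part and `η = I` the imaginary part.
  have k1 := key 1 (by simp)
  have k2 := key Complex.I (by simp)
  have hre := integral_re (𝕜 := ℂ) hi
  have him := integral_im (𝕜 := ℂ) hi
  simp only [RCLike.re_eq_complex_re, RCLike.im_eq_complex_im, Complex.re_mul_ofReal,
    Complex.im_mul_ofReal, Complex.conj_re, Complex.conj_im, neg_mul] at hre him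
  rw [integral_neg] at him
  simp only [map_one, one_mul] at k1
  simp only [Complex.conj_I, Complex.neg_re, Complex.I_mul_re, neg_mul, neg_neg] at k2
  rw [integral_neg] at k2
  have h2 : (2 : ℂ) = ((2 : ℝ) : ℂ) := by norm_num
  apply Complex.ext
  · rw [h2, Complex.re_ofReal_mul, ← hre]; linarith
  · rw [h2, Complex.im_ofReal_mul, ← him]; linarith

/-! ### Two uniqueness statements -/

/-- For real `q` the coefficients at `n` and `-n` are conjugate, so one-sided vanishing is two-sided
and only `±1` remain. -/
theorem exists_ae_eq_neilWeight {q : Torus → ℝ} (hq : Integrable q arc)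
    (h0 : ∫ t, q t ∂arc = 0) (h : ∀ n < -1, fourierCoeff (fun t => (q t : ℂ)) n = 0) :
    ∃ a : ℂ, ∀ᵐ t ∂arc, q t = neilWeight a t := by
  set Q : Torus → ℂ := fun t => (q t : ℂ) with hQ
  have hconj : ∀ n, fourierCoeff Q (-n) = conj (fourierCoeff Q n) := by
    intro n
    rw [fourierCoeff, fourierCoeff, ← integral_conj]
    congr 1
    ext t
    simp only [hQ, smul_eq_mul, map_mul, Complex.conj_ofReal, ← fourier_neg]
  have hz : fourierCoeff Q 0 = 0 := by
    simp only [fourierCoeff, neg_zero, fourier_zero, one_smul, hQ]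
    rw [integral_complex_ofReal, h0, Complex.ofReal_zero]
  refine ⟨fourierCoeff Q 1, ?_⟩
  set a := fourierCoeff Q 1 with ha
  have hi : ∀ (b : ℂ) (k : ℤ), Integrable (fun t : Torus => b * fourier k t) arc := fun b k =>
    (continuous_const.mul (map_continuous (fourier (T := 2 * Real.pi) k))
      ).integrable_of_hasCompactSupport (HasCompactSupport.of_compactSpace _)
  have hsum := ae_eq_zero_of_fourierCoeff_eq_zero
    (q := Q + ((fun t : Torus => -a * fourier 1 t) + fun t : Torus => -conj a * fourier (-1) t))
    (hq.ofReal.add ((hi _ _).add (hi _ _))) (fun n => by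
      rw [fourierCoeff.add (f := Q) hq.ofReal ((hi _ _).add (hi _ _)), fourierCoeff.add (hi _ _) (hi _ _),
        Pi.add_apply, Pi.add_apply, fourierCoeff.const_mul, fourierCoeff.const_mul,
        fourierCoeff_fourier, fourierCoeff_fourier]
      rcases lt_trichotomy n 0 with hn | rfl | hn
      · rcases eq_or_lt_of_le (show n ≤ -1 by omega) with rfl | hn
        · rw [hconj 1]; simp [ha]
        · rw [h n hn]; simp [show n ≠ 1 by omega, show n ≠ -1 by omega]
      · rw [hz]; simp
      · rcases eq_or_lt_of_le (show 1 ≤ n by omega) with rfl | hn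
        · simp [ha]
        · have h1 := hconj n
          rw [h (-n) (by omega)] at h1
          rw [(map_eq_zero _).1 h1.symm]
          simp [show n ≠ 1 by omega, show n ≠ -1 by omega])
  filter_upwards [hsum] with t ht
  have h1 : Q t + (-a * fourier 1 t + -conj a * fourier (-1) t) = 0 := ht
  rw [fourier_neg] at h1
  have h2 : (q t : ℂ) = (neilWeight a t : ℂ) := by
    rw [neilWeight, Complex.ofReal_mul, Complex.re_eq_add_conj, map_mul]
    push_cast
    linear_combination h1
  exact_mod_cast h2

/-- The function and its rotation by `π` both have one-sided spectrum, so their coefficients form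
formal power series with product zero. Formal power series over `ℂ` have no zero divisors; no
boundary uniqueness theorem is needed. -/
theorem ae_eq_zero_of_mul_add_pi {f : Torus → ℂ} (hf : MemLp f 2 arc)
    (hf0 : ∀ n < 0, fourierCoeff f n = 0)
    (h : ∀ᵐ t ∂arc, f t * f (t + ((Real.pi : ℝ) : Torus)) = 0) : f =ᵐ[arc] 0 := by
  set p : Torus := ((Real.pi : ℝ) : Torus) with hp
  have hg : MemLp (fun t => f (t + p)) 2 arc :=
    hf.comp_measurePreserving (measurePreserving_add_right arc p)
  have hco : ∀ n, fourierCoeff (fun t => f (t + p)) n = fourier n p * fourierCoeff f n := by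
    intro n
    rw [fourierCoeff, fourierCoeff, ← integral_const_mul,
      ← integral_add_pi fun t => fourier n p * (fourier (-n) t • f t)]
    congr 1
    ext t
    have h1 : ∀ s : Torus, fourier (-n) (s + p) = fourier (-n) s * fourier (-n) p := by
      intro s
      simp only [fourier_apply, smul_add, toCircle_add, Circle.coe_mul]
    have h2 : fourier n p * fourier (-n) p = 1 := by
      rw [← fourier_add, add_neg_cancel, fourier_zero]
    simp only [smul_eq_mul, ← hp]
    rw [h1]
    linear_combination (-(fourier (-n) t * f (t + p))) * h2
  have hzero : ∀ n : ℕ, fourierCoeff f n = 0 := by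
    let P : PowerSeries ℂ := PowerSeries.mk fun n => fourierCoeff f n
    let R : PowerSeries ℂ := PowerSeries.mk fun n => fourierCoeff (fun t => f (t + p)) n
    have hPR : P * R = 0 := by
      ext n
      rw [PowerSeries.coeff_mul, map_zero]
      simp only [P, R, PowerSeries.coeff_mk]
      rw [← fourierCoeff_mul_of_nonneg hf hg hf0 (fun n hn => by rw [hco, hf0 n hn, mul_zero]),
        fourierCoeff_congr_ae (g := 0) h]
      simp [fourierCoeff]
    intro n
    rcases mul_eq_zero.1 hPR with h1 | h1
    · have := congrArg (PowerSeries.coeff n) h1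
      simpa [P] using this
    · have := congrArg (PowerSeries.coeff n) h1
      simp only [R, PowerSeries.coeff_mk, map_zero] at this
      rw [hco] at this
      refine (mul_eq_zero.1 this).resolve_left ?_
      rw [← Ne, ← norm_pos_iff, norm_fourier_apply]
      exact one_pos
  refine ae_eq_zero_of_fourierCoeff_eq_zero (hf.integrable one_le_two) fun n => ?_
  rcases lt_or_ge n 0 with hn | hn
  · exact hf0 n hn
  · lift n to ℕ using hn
    exact hzero n

/-! ### Eigenvectors of Toeplitz operators -/

theorem inner_fourierLp (n : ℤ) (f : L2) :
    inner ℂ (fourierLp 2 n : L2) f = fourierCoeff f n := by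
  rw [← fourierBasis_repr, HilbertBasis.repr_apply_apply, coe_fourierBasis]

theorem fourierCoeff_eq_zero_of_mem_hardy {f : L2} (hf : f ∈ hardy) {n : ℤ} (hn : n < 0) :
    fourierCoeff f n = 0 := by
  have hle : hardy ≤ (Submodule.span ℂ {(fourierLp 2 n : L2)})ᗮ := by
    refine Submodule.topologicalClosure_minimal _ (Submodule.span_le.2 ?_)
      (Submodule.isClosed_orthogonal _)
    rintro _ ⟨k, rfl⟩
    rw [SetLike.mem_coe, Submodule.mem_orthogonal_singleton_iff_inner_right]
    exact orthonormal_fourier.2 (by omega)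
  rw [← inner_fourierLp]
  exact Submodule.mem_orthogonal_singleton_iff_inner_right.1 (hle hf)

theorem fourierLp_mem_hardySub {V : Submodule ℂ L2} (hV : V ≤ linearPolys) {n : ℤ} (hn : 2 ≤ n) :
    (fourierLp 2 n : L2) ∈ hardySub V := by
  refine ⟨?_, Submodule.orthogonal_le hV ?_⟩
  · lift n to ℕ using by omega
    exact Submodule.le_topologicalClosure _ (Submodule.subset_span ⟨n, rfl⟩)
  · rw [linearPolys, Submodule.mem_orthogonal]
    intro u hu
    induction hu using Submodule.span_induction with
    | mem x hx =>
      rcases hx with rfl | rfl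
      · exact orthonormal_fourier.2 (by omega)
      · exact orthonormal_fourier.2 (by omega)
    | zero => exact inner_zero_left _
    | add x y _ _ hx hy => rw [inner_add_left, hx, hy, add_zero]
    | smul k x _ hx => rw [inner_smul_left, hx, mul_zero]

theorem coeFn_mulOp (φ : Lp ℝ ∞ arc) (f : L2) :
    (mulOp φ f : L2) =ᵐ[arc] fun t => (φ t : ℂ) * f t := by
  have h := Lp.coeFn_lpSMul φ f (r := 2)
  filter_upwards [h] with t ht
  refine Eq.trans ht ?_
  rw [Pi.smul_apply', Complex.real_smul]

theorem inner_toeplitz (φ : Lp ℝ ∞ arc) (V : Submodule ℂ L2) (x y : hardySub V) :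
    inner ℂ y (toeplitz φ V x) = inner ℂ (y : L2) (mulOp φ (x : L2)) :=
  Submodule.inner_orthogonalProjectionOnto_eq_of_mem_left y _

theorem inner_mulOp (φ : Lp ℝ ∞ arc) (f g : L2) :
    inner ℂ g (mulOp φ f) = inner ℂ (mulOp φ g) f := by
  rw [L2.inner_def, L2.inner_def]
  refine integral_congr_ae ?_
  filter_upwards [coeFn_mulOp φ f, coeFn_mulOp φ g] with t h1 h2
  rw [h1, h2]
  simp only [RCLike.inner_apply, map_mul, Complex.conj_ofReal]
  ring

theorem isSymmetric_toeplitz (φ : Lp ℝ ∞ arc) (V : Submodule ℂ L2) :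
    (toeplitz φ V : hardySub V →ₗ[ℂ] hardySub V).IsSymmetric := by
  intro x y
  simp only [ContinuousLinearMap.coe_coe]
  rw [inner_toeplitz, ← inner_conj_symm, inner_toeplitz, inner_conj_symm, inner_mulOp]

theorem exists_factorization_of_hasEigenvalue {φ : Lp ℝ ∞ arc} {V : Submodule ℂ L2}
    (hV : V ≤ linearPolys) {μ : ℂ}
    (h : Module.End.HasEigenvalue (toeplitz φ V : hardySub V →ₗ[ℂ] hardySub V) μ) :
    ∃ (lam : ℝ) (f : L2), f ∈ hardySub V ∧ f ≠ 0 ∧ ∃ (g : Torus → ℂ) (a : ℂ),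
      MemLp g 2 arc ∧ (∀ n < 0, fourierCoeff g n = 0) ∧
      (∀ᵐ t ∂arc, (φ t - lam) * ‖f t‖ ^ 2 = neilWeight a t) ∧
      ∀ᵐ t ∂arc, f t * g t = conj a + a * fourier 1 t ^ 2 := by
  obtain ⟨lam, rfl⟩ := Complex.conj_eq_iff_real.1 ((isSymmetric_toeplitz φ V).conj_eigenvalue_eq_self h)
  obtain ⟨x, hx⟩ := h.exists_hasEigenvector
  set f : L2 := (x : L2) with hf
  have hTx : toeplitz φ V x = (lam : ℂ) • x := hx.apply_eq_smul
  have hfne : f ≠ 0 := fun h0 => hx.2 (Subtype.ext h0)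
  set F : L2 := mulOp φ f - (lam : ℂ) • f with hF
  have hFae : F =ᵐ[arc] fun t => ((φ t - lam : ℝ) : ℂ) * f t := by
    filter_upwards [Lp.coeFn_sub (mulOp φ f) ((lam : ℂ) • f), coeFn_mulOp φ f,
      Lp.coeFn_smul (lam : ℂ) f] with t h1 h2 h3
    rw [hF, h1, Pi.sub_apply, h2, h3, Pi.smul_apply, smul_eq_mul]
    push_cast
    ring
  have horth : ∀ y ∈ hardySub V, inner ℂ y F = 0 := by
    intro y hy
    have h1 := inner_toeplitz φ V x ⟨y, hy⟩
    rw [hTx] at h1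
    rw [hF, inner_sub_right, ← h1]
    exact sub_self _
  have hFco : ∀ n : ℤ, 2 ≤ n → fourierCoeff F n = 0 := fun n hn => by
    rw [← inner_fourierLp]
    exact horth _ (fourierLp_mem_hardySub hV hn)
  have hfmem := Lp.memLp f
  have hFmem := Lp.memLp F
  -- The factor `z` matches the threshold `2`: `ĝ(n)` is the conjugate of `F̂(1 - n)`, and `n < 0`
  -- means `1 - n ≥ 2`.
  let g : Torus → ℂ := fun t => fourier 1 t * conj (F t)
  have hg : MemLp g 2 arc := by
    refine (hFmem.star).of_le_mul (c := 1) ?_ (ae_of_all _ fun t => ?_)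
    · exact (map_continuous (fourier (T := 2 * Real.pi) 1)).aestronglyMeasurable.mul hFmem.star.1
    · simp only [g, norm_mul, norm_fourier_apply, one_mul]
      rfl
  have hgco : ∀ n < 0, fourierCoeff g n = 0 := by
    intro n hn
    have h1 := hFco (1 - n) (by omega)
    rw [fourierCoeff, ← (map_eq_zero (starRingEnd ℂ)), ← integral_conj] at h1
    rw [fourierCoeff, ← h1]
    congr 1
    ext t
    simp only [g, smul_eq_mul, map_mul, ← fourier_neg, neg_neg]
    rw [← mul_assoc, ← fourier_add]
    congr 3; ring
  have hf0 : ∀ n < 0, fourierCoeff f n = 0 := fun n hn =>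
    fourierCoeff_eq_zero_of_mem_hardy x.2.1 hn
  let q : Torus → ℝ := fun t => (φ t - lam) * ‖f t‖ ^ 2
  have hqF : ∀ᵐ t ∂arc, (q t : ℂ) = conj (f t) * F t := by
    filter_upwards [hFae] with t ht
    rw [ht]
    simp only [q]
    push_cast
    rw [← Complex.conj_mul']
    ring
  have hqi : Integrable (fun t => (q t : ℂ)) arc := by
    refine Integrable.congr ?_ (hqF.mono fun t ht => ht.symm)
    exact hfmem.star.integrable_mul hFmem
  have hfg : ∀ᵐ t ∂arc, f t * g t = fourier 1 t * (q t : ℂ) := by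
    filter_upwards [hqF] with t ht
    have h1 := congrArg conj ht
    rw [Complex.conj_ofReal, map_mul, Complex.conj_conj] at h1
    rw [h1]
    ring
  -- The eigenvector lies in `H²_V` itself, so it may be paired with `F`.
  have hqint : ∫ t, q t ∂arc = 0 := by
    have h1 := horth f x.2
    rw [L2.inner_def] at h1
    have h2 : ∫ t, (q t : ℂ) ∂arc = 0 := by
      rw [← h1]
      refine integral_congr_ae ?_
      filter_upwards [hqF] with t ht
      rw [ht, RCLike.inner_apply, mul_comm]
    rw [integral_complex_ofReal] at h2
    exact_mod_cast h2
  -- `z q = f g` has no negative frequencies, hence `q` has none below `-1`.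
  have hqco : ∀ n < -1, fourierCoeff (fun t => (q t : ℂ)) n = 0 := by
    intro n hn
    rw [← fourierCoeff_mul_of_neg hfmem hg hf0 hgco (show n + 1 < 0 by omega),
      fourierCoeff_congr_ae hfg, fourierCoeff, fourierCoeff]
    congr 1
    ext t
    simp only [smul_eq_mul]
    rw [← mul_assoc, ← fourier_add]
    congr 3; ring
  obtain ⟨a, ha⟩ := exists_ae_eq_neilWeight (q := q) hqi.re hqint hqco
  refine ⟨lam, f, x.2, hfne, g, a, hg, hgco, ha, ?_⟩
  filter_upwards [ha, hfg] with t h1 h2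
  rw [h2, h1, fourier_one_mul_neilWeight]

/-- The conjugate first moment `-∫ z̄ log |φ - λ|`. -/
noncomputable def logMoment (φ : Lp ℝ ∞ arc) (lam : ℝ) : ℂ :=
  -∫ t, conj (fourier 1 t) * (Real.log |φ t - lam| : ℂ) ∂arc

theorem integrable_conj_fourier_one_mul {u : Torus → ℝ} (hu : Integrable u arc) :
    Integrable (fun t => conj (fourier 1 t) * (u t : ℂ)) arc := by
  refine hu.ofReal.bdd_mul (c := 1) (Complex.continuous_conj.comp
    (map_continuous (fourier (T := 2 * Real.pi) 1))).aestronglyMeasurable (ae_of_all _ fun t => ?_)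
  rw [Complex.norm_conj, norm_fourier_apply]

theorem coeff_ratio_eq_logMoment {φ : Lp ℝ ∞ arc} {f : L2} (hf0 : ∀ n < 0, fourierCoeff f n = 0)
    {g : Torus → ℂ} (hg : MemLp g 2 arc) (hg0 : ∀ n < 0, fourierCoeff g n = 0) {a : ℂ}
    (ha : a ≠ 0) {lam : ℝ} (hq : ∀ᵐ t ∂arc, (φ t - lam) * ‖f t‖ ^ 2 = neilWeight a t)
    (hfg : ∀ᵐ t ∂arc, f t * g t = conj a + a * fourier 1 t ^ 2) :
    fourierCoeff f 0 ≠ 0 ∧ fourierCoeff f 1 / fourierCoeff f 0 = logMoment φ lam := by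
  have hf := Lp.memLp f
  constructor
  · have := diskExt_ne_zero_of_mul_ae_eq hf hg hf0 hg0 ha hfg (Metric.mem_ball_self one_pos)
    rw [diskExt_zero] at this
    exact left_ne_zero_of_mul this
  have hl := integrable_log_norm_of_mul_ae_eq hf hg ha hfg
  have hw := integrable_log_abs_neilWeight ha
  have hlog : ∀ᵐ t ∂arc, Real.log |φ t - lam| =
      Real.log |neilWeight a t| - 2 * Real.log ‖f t‖ := by
    filter_upwards [hq, ae_neilWeight_ne_zero ha] with t h1 h2
    rw [← h1] at h2 ⊢
    have h3 := left_ne_zero_of_mul h2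
    have h4 := right_ne_zero_of_mul h2
    rw [abs_mul, Real.log_mul (abs_ne_zero.2 h3) (abs_ne_zero.2 h4), Real.log_abs (‖f t‖ ^ 2),
      Real.log_pow]
    push_cast
    ring
  have i1 := integrable_conj_fourier_one_mul hw
  have i2 := (integrable_conj_fourier_one_mul hl).const_mul 2
  rw [coeff_ratio_eq_integral_log_norm hf hg hf0 hg0 ha hfg, logMoment]
  have h5 : ∫ t, conj (fourier 1 t) * (Real.log |φ t - lam| : ℂ) ∂arc =
      ∫ t, (conj (fourier 1 t) * (Real.log |neilWeight a t| : ℂ) -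
        2 * (conj (fourier 1 t) * (Real.log ‖f t‖ : ℂ))) ∂arc := by
    refine integral_congr_ae ?_
    filter_upwards [hlog] with t ht
    rw [ht]
    push_cast
    ring
  rw [h5, integral_sub i1 i2, integral_conj_mul_log_abs_neilWeight, integral_const_mul]
  ring

/-- Of two antipodal points, almost surely one lies in the half circle, so `f(z) f(-z) = 0`. -/
theorem ae_eq_zero_of_half_circle {c : ℂ} (hc : c ≠ 0) {f : Torus → ℂ} (hf : MemLp f 2 arc)
    (hf0 : ∀ n < 0, fourierCoeff f n = 0) (h : ∀ᵐ t ∂arc, 0 < neilWeight c t → f t = 0) :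
    f =ᵐ[arc] 0 := by
  refine ae_eq_zero_of_mul_add_pi hf hf0 ?_
  filter_upwards [h, ae_add_pi h, ae_neilWeight_ne_zero hc] with t h1 h2 h3
  rw [neilWeight_add_pi] at h2
  rcases lt_or_gt_of_ne h3 with h4 | h4
  · rw [h2 (by linarith), mul_zero]
  · rw [h1 h4, zero_mul]

theorem neilWeight_neg (c : ℂ) (t : Torus) : neilWeight (-c) t = -neilWeight c t := by
  rw [neilWeight, neilWeight, neg_mul, Complex.neg_re, mul_neg]

/-- Both weights change sign under rotation by `π`, so a sign of `ψ` on one half circle forces the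
opposite sign on the other. With `ψ = ±(φ - λ)` this confines `λ` to `[m, M]`. -/
theorem ae_sub_mul_neg_of_ae_sub_mul_pos {c a : ℂ} (ha : a ≠ 0) {ψ : Torus → ℝ} {w : Torus → ℝ}
    (hw : ∀ t, 0 ≤ w t) (hq : ∀ᵐ t ∂arc, ψ t * w t = neilWeight a t)
    (hpos : ∀ᵐ t ∂arc, 0 < neilWeight c t → 0 < ψ t) :
    ∀ᵐ t ∂arc, neilWeight c t < 0 → ψ t < 0 := by
  have h1 : ∀ᵐ t ∂arc, 0 < neilWeight c t → 0 ≤ neilWeight a t := by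
    filter_upwards [hq, hpos] with t h2 h3 h4
    rw [← h2]
    exact mul_nonneg (h3 h4).le (hw t)
  filter_upwards [hq, ae_add_pi h1, ae_neilWeight_ne_zero ha] with t h2 h3 h4 h5
  rw [neilWeight_add_pi, neilWeight_add_pi] at h3
  have h6 : neilWeight a t < 0 := lt_of_le_of_ne (by linarith [h3 (by linarith)]) h4
  rw [← h2] at h6
  by_contra h7
  exact absurd h6 (not_lt.2 (mul_nonneg (not_lt.1 h7) (hw t)))

theorem exists_coeff_ratio_of_hasEigenvalue {φ : Lp ℝ ∞ arc} {c : ℂ} (hc : c ≠ 0) {m M : ℝ}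
    (hmM : m < M) (hm : ∀ᵐ t ∂arc, neilWeight c t < 0 → φ t ≤ m)
    (hm' : ∀ r : ℝ, (∀ᵐ t ∂arc, neilWeight c t < 0 → φ t ≤ r) → m ≤ r)
    (hM : ∀ᵐ t ∂arc, 0 < neilWeight c t → M ≤ φ t)
    (hM' : ∀ r : ℝ, (∀ᵐ t ∂arc, 0 < neilWeight c t → r ≤ φ t) → r ≤ M)
    {V : Submodule ℂ L2} (hV : V ≤ linearPolys) {μ : ℂ}
    (h : Module.End.HasEigenvalue (toeplitz φ V : hardySub V →ₗ[ℂ] hardySub V) μ) :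
    ∃ lam ∈ Icc m M, ∃ f ∈ hardySub V, fourierCoeff f 0 ≠ 0 ∧
      fourierCoeff f 1 / fourierCoeff f 0 = logMoment φ lam := by
  obtain ⟨lam, f, hfV, hfne, g, a, hg, hg0, hq, hfg⟩ := exists_factorization_of_hasEigenvalue hV h
  have hf0 : ∀ n < 0, fourierCoeff f n = 0 := fun n hn =>
    fourierCoeff_eq_zero_of_mem_hardy hfV.1 hn
  -- If `a = 0`, then `f` lives where `φ = λ`. Since `m < M`, this misses a half circle, whence `f =
  -- 0`.
  have ha : a ≠ 0 := by
    rintro rfl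
    refine hfne ((Lp.eq_zero_iff_ae_eq_zero).2 ?_)
    have hq' : ∀ᵐ t ∂arc, φ t ≠ lam → f t = 0 := by
      filter_upwards [hq] with t ht hne
      rw [neilWeight, zero_mul, Complex.zero_re, mul_zero] at ht
      simpa using (mul_eq_zero.1 ht).resolve_left (sub_ne_zero.2 hne)
    rcases lt_or_ge lam M with hlam | hlam
    · refine ae_eq_zero_of_half_circle hc (Lp.memLp f) hf0 ?_
      filter_upwards [hq', hM] with t h1 h2 h3
      exact h1 (hlam.trans_le (h2 h3)).ne'
    · refine ae_eq_zero_of_half_circle (neg_ne_zero.2 hc) (Lp.memLp f) hf0 ?_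
      filter_upwards [hq', hm] with t h1 h2 h3
      rw [neilWeight_neg] at h3
      exact h1 (((h2 (by linarith)).trans_lt hmM).trans_le hlam).ne
  refine ⟨lam, ⟨?_, ?_⟩, f, hfV, coeff_ratio_eq_logMoment hf0 hg hg0 ha hq hfg⟩
  -- If `λ < m`, then `φ > λ` on the positive half circle, so `φ < λ` on the negative one, and `m`
  -- is not the least essential bound.
  · by_contra! hlt
    have h1 := ae_sub_mul_neg_of_ae_sub_mul_pos (c := c) ha (ψ := fun t => φ t - lam)
      (w := fun t => ‖f t‖ ^ 2) (fun t => by positivity) hq (by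
        filter_upwards [hM] with t ht h2
        linarith [ht h2])
    exact absurd (hm' lam (h1.mono fun t ht h2 => by linarith [ht h2])) (not_le.2 hlt)
  · by_contra! hlt
    have h1 := ae_sub_mul_neg_of_ae_sub_mul_pos (c := -c) (neg_ne_zero.2 ha)
      (ψ := fun t => lam - φ t) (w := fun t => ‖f t‖ ^ 2) (fun t => by positivity) (by
        filter_upwards [hq] with t ht
        rw [neilWeight_neg, ← ht]; ring) (by
        filter_upwards [hm] with t ht h2
        rw [neilWeight_neg] at h2
        linarith [ht (by linarith)])
    refine absurd (hM' lam (h1.mono fun t ht h2 => ?_)) (not_le.2 hlt)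
    rw [neilWeight_neg] at ht
    linarith [ht (by linarith)]

/-! ### Differentiability of the outer functions at the origin -/

theorem hasDerivAt_integral_herglotz_zero {u : Torus → ℝ} (hu : Integrable u arc) :
    HasDerivAt (fun z => ∫ t, herglotz z t * (u t : ℂ) ∂arc)
      (2 * ∫ t, conj (fourier 1 t) * (u t : ℂ) ∂arc) 0 := by
  have hden : ∀ z ∈ Metric.ball (0 : ℂ) (1 / 2), ∀ t : Torus, 1 / 2 ≤ ‖fourier 1 t - z‖ := by
    intro z hz t
    rw [mem_ball_zero_iff] at hz
    have := norm_sub_norm_le (fourier 1 t) z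
    rw [norm_fourier_apply] at this
    linarith
  have hden0 : ∀ z ∈ Metric.ball (0 : ℂ) (1 / 2), ∀ t : Torus, fourier 1 t - z ≠ 0 := by
    intro z hz t
    rw [← norm_pos_iff]
    linarith [hden z hz t]
  have hec := map_continuous (fourier (T := 2 * Real.pi) 1)
  have hnhds : Metric.ball (0 : ℂ) (1 / 2) ∈ 𝓝 (0 : ℂ) := Metric.ball_mem_nhds _ (by norm_num)
  have hHc : ∀ z ∈ Metric.ball (0 : ℂ) (1 / 2), Continuous (herglotz z) := fun z hz =>
    (hec.add continuous_const).div (hec.sub continuous_const) (hden0 z hz)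
  have hderc : ∀ z ∈ Metric.ball (0 : ℂ) (1 / 2),
      Continuous fun t : Torus => 2 * fourier 1 t / (fourier 1 t - z) ^ 2 := fun z hz =>
    (continuous_const.mul hec).div ((hec.sub continuous_const).pow 2)
      fun t => pow_ne_zero 2 (hden0 z hz t)
  have h0 := mem_of_mem_nhds hnhds
  have hmeas : ∀ᶠ z in 𝓝 (0 : ℂ),
      AEStronglyMeasurable (fun t => herglotz z t * (u t : ℂ)) arc := by
    filter_upwards [hnhds] with z hz
    exact (hHc z hz).aestronglyMeasurable.mul hu.ofReal.1
  have hint : Integrable (fun t => herglotz 0 t * (u t : ℂ)) arc := by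
    refine hu.ofReal.bdd_mul (c := 1) (hHc 0 h0).aestronglyMeasurable (ae_of_all _ fun t => ?_)
    rw [herglotz, add_zero, sub_zero, div_self (fourier_one_ne_zero t), norm_one]
  have hmeas' : AEStronglyMeasurable
      (fun t : Torus => 2 * fourier 1 t / (fourier 1 t - 0) ^ 2 * (u t : ℂ)) arc :=
    (hderc 0 h0).aestronglyMeasurable.mul hu.ofReal.1
  -- The constant is `8 = 2 / (1/2)²`.
  have hbound : ∀ᵐ t ∂arc, ∀ z ∈ Metric.ball (0 : ℂ) (1 / 2),
      ‖2 * fourier 1 t / (fourier 1 t - z) ^ 2 * (u t : ℂ)‖ ≤ 8 * |u t| := by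
    refine ae_of_all _ fun t z hz => ?_
    rw [norm_mul, norm_div, norm_mul, norm_fourier_apply, norm_pow, Complex.norm_real,
      Real.norm_eq_abs, mul_one, Complex.norm_ofNat]
    gcongr
    have h1 := hden z hz t
    have h2 : (1 / 2 : ℝ) ^ 2 ≤ ‖fourier 1 t - z‖ ^ 2 := by gcongr
    rw [div_le_iff₀ (by positivity)]
    linarith
  have hderiv : ∀ᵐ t ∂arc, ∀ z ∈ Metric.ball (0 : ℂ) (1 / 2),
      HasDerivAt (fun z => herglotz z t * (u t : ℂ))
        (2 * fourier 1 t / (fourier 1 t - z) ^ 2 * (u t : ℂ)) z := by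
    refine ae_of_all _ fun t z hz => ?_
    have h1 : HasDerivAt (fun z => herglotz z t) _ z :=
      ((hasDerivAt_id z).const_add (fourier 1 t)).div
        ((hasDerivAt_id z).const_sub (fourier 1 t)) (hden0 z hz t)
    refine (h1.congr_deriv ?_).mul_const _
    simp only [id]
    congr 1
    ring
  have key := hasDerivAt_integral_of_dominated_loc_of_deriv_le
    (F := fun z t => herglotz z t * (u t : ℂ))
    (F' := fun z t => 2 * fourier 1 t / (fourier 1 t - z) ^ 2 * (u t : ℂ))
    (bound := fun t => 8 * |u t|) hnhds hmeas hint hmeas' hbound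
    (hu.abs.const_mul 8) hderiv
  refine key.2.congr_deriv ?_
  rw [← integral_const_mul]
  refine integral_congr_ae (ae_of_all _ fun t => ?_)
  have h1 := fourier_one_ne_zero t
  have h2 : conj (fourier 1 t) = (fourier 1 t)⁻¹ :=
    eq_inv_of_mul_eq_one_right (fourier_one_mul_conj t)
  simp only [h2, sub_zero]
  field_simp

theorem hasDerivAt_outerExp_zero {u : Torus → ℝ} (hu : Integrable u arc) :
    HasDerivAt (outerExp u)
      (outerExp u 0 * (2 * ∫ t, conj (fourier 1 t) * (u t : ℂ) ∂arc)) 0 :=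
  (hasDerivAt_integral_herglotz_zero hu).cexp

theorem hLog_eq (c : ℂ) (t : Torus) : hLog c t = 1 / 2 * Real.log |neilWeight c t| := by
  rw [hLog]
  rcases eq_or_lt_of_le (abs_nonneg (neilWeight c t)) with h | h
  · rw [← h, Real.zero_rpow (by norm_num)]; simp
  · rw [Real.log_rpow h]

theorem gLog_eq (φ : Lp ℝ ∞ arc) (lam : ℝ) (t : Torus) :
    gLog φ lam t = -1 / 2 * Real.log |φ t - lam| := by
  rw [gLog]
  -- Where `φ = λ` both sides are `0`, by the conventions `0 ^ (-1/2) = 0` and `log 0 = 0`.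
  rcases eq_or_lt_of_le (abs_nonneg (φ t - lam)) with h | h
  · rw [← h, Real.zero_rpow (by norm_num)]; simp
  · rw [Real.log_rpow h]

theorem integrable_hLog {c : ℂ} (hc : c ≠ 0) : Integrable (hLog c) arc := by
  rw [funext (hLog_eq c)]
  exact (integrable_log_abs_neilWeight hc).const_mul _

theorem deriv_hFun_zero {c : ℂ} (hc : c ≠ 0) : deriv (hFun c) 0 = 0 := by
  rw [hFun, (hasDerivAt_outerExp_zero (integrable_hLog hc)).deriv]
  have h : ∀ t, conj (fourier 1 t) * (hLog c t : ℂ) =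
      1 / 2 * (conj (fourier 1 t) * (Real.log |neilWeight c t| : ℂ)) := by
    intro t
    rw [hLog_eq]
    push_cast
    ring
  simp_rw [h]
  rw [integral_const_mul, integral_conj_mul_log_abs_neilWeight, mul_zero, mul_zero, mul_zero]

theorem deriv_gFun_zero {φ : Lp ℝ ∞ arc} {lam : ℝ} (hg : Integrable (gLog φ lam) arc) :
    deriv (gFun φ lam) 0 = gFun φ lam 0 * logMoment φ lam := by
  rw [gFun, (hasDerivAt_outerExp_zero hg).deriv, logMoment]
  have h : ∀ t, conj (fourier 1 t) * (gLog φ lam t : ℂ) =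
      -1 / 2 * (conj (fourier 1 t) * (Real.log |φ t - lam| : ℂ)) := by
    intro t
    rw [gLog_eq]
    push_cast
    ring
  simp_rw [h]
  rw [integral_const_mul]
  ring

/-! ### The affine chart of the projective line -/

theorem affineVec_ne_zero (ζ : ℂ) : (!₂[1, ζ] : C2) ≠ 0 := by
  intro h
  have h0 : (!₂[1, ζ] : C2) 0 = 0 := by rw [h]; rfl
  exact one_ne_zero (α := ℂ) h0

/-- The line `[1 : ζ]`. -/
noncomputable def affineLine (ζ : ℂ) : ℙ ℂ C2 := Projectivization.mk ℂ !₂[1, ζ] (affineVec_ne_zero ζ)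

/-- Because `h_c'(0) = 0` and `g_λ'(0) = g_λ(0) · logMoment φ λ`, the common factor `h_c(0) g_λ(0)`
cancels. -/
theorem lamMap_eq_affineLine {c : ℂ} (hc : c ≠ 0) {φ : Lp ℝ ∞ arc} {lam : ℝ}
    (hg : Integrable (gLog φ lam) arc) : lamMap c φ lam = affineLine (logMoment φ lam) := by
  rw [lamMap, affineLine, Projectivization.mk_eq_mk_iff']
  refine ⟨hFun c 0 * gFun φ lam 0, ?_⟩
  rw [lamVec, deriv_hFun_zero hc, deriv_gFun_zero hg]
  ext i
  fin_cases i
  · simp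
  · simp
    ring

theorem norm_unit_sub_unit_le {E : Type*} [NormedAddCommGroup E] [NormedSpace ℂ E] {v w : E}
    (hv : 1 ≤ ‖v‖) (hw : w ≠ 0) :
    ‖((‖v‖⁻¹ : ℝ) : ℂ) • v - ((‖w‖⁻¹ : ℝ) : ℂ) • w‖ ≤ 2 * ‖v - w‖ := by
  have hv0 : 0 < ‖v‖ := one_pos.trans_le hv
  have hw0 : 0 < ‖w‖ := norm_pos_iff.2 hw
  have h1 : ((‖v‖⁻¹ : ℝ) : ℂ) • v - ((‖w‖⁻¹ : ℝ) : ℂ) • w =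
      ((‖v‖⁻¹ : ℝ) : ℂ) • (v - w) + ((‖v‖⁻¹ - ‖w‖⁻¹ : ℝ) : ℂ) • w := by
    push_cast
    module
  have h2 : ‖((‖v‖⁻¹ - ‖w‖⁻¹ : ℝ) : ℂ) • w‖ = ‖v‖⁻¹ * |‖w‖ - ‖v‖| := by
    rw [norm_smul, Complex.norm_real, Real.norm_eq_abs, inv_sub_inv hv0.ne' hw0.ne', abs_div,
      abs_of_pos (mul_pos hv0 hw0)]
    field_simp
  have h3 : ‖v‖⁻¹ ≤ 1 := inv_le_one_of_one_le₀ hv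
  have h4 : |‖w‖ - ‖v‖| ≤ ‖v - w‖ := by
    rw [norm_sub_rev]; exact abs_norm_sub_norm_le w v
  rw [h1]
  refine (norm_add_le _ _).trans ?_
  rw [h2, norm_smul, Complex.norm_real, Real.norm_of_nonneg (inv_nonneg.2 hv0.le)]
  have h5 : ‖v‖⁻¹ * ‖v - w‖ ≤ 1 * ‖v - w‖ := by gcongr
  have h6 : ‖v‖⁻¹ * |‖w‖ - ‖v‖| ≤ 1 * ‖v - w‖ := by gcongr
  linarith

theorem norm_starProjection_singleton_sub_le {E : Type*} [NormedAddCommGroup E]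
    [InnerProductSpace ℂ E] {u v : E} (hu : ‖u‖ = 1) (hv : ‖v‖ = 1) :
    ‖(ℂ ∙ u).starProjection - (ℂ ∙ v).starProjection‖ ≤ 2 * ‖u - v‖ := by
  refine ContinuousLinearMap.opNorm_le_bound _ (by positivity) fun w => ?_
  rw [sub_apply, Submodule.starProjection_unit_singleton _ hu,
    Submodule.starProjection_unit_singleton _ hv]
  have h1 : inner ℂ u w • u - inner ℂ v w • v = inner ℂ (u - v) w • u + inner ℂ v w • (u - v) := by
    rw [inner_sub_left]
    module
  rw [h1]
  refine (norm_add_le _ _).trans ?_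
  rw [norm_smul, norm_smul, hu]
  have h2 := norm_inner_le_norm (𝕜 := ℂ) (u - v) w
  have h3 := norm_inner_le_norm (𝕜 := ℂ) v w
  rw [hv] at h3
  have h4 : ‖inner ℂ v w‖ * ‖u - v‖ ≤ 1 * ‖w‖ * ‖u - v‖ := by gcongr
  linarith

/-- One factor `2` comes from normalizing the vectors, whose norm is at least `1`, the other from
passing to projections. -/
theorem lipschitzWith_affineLine : LipschitzWith 4 affineLine := by
  refine LipschitzWith.of_dist_le_mul fun ζ ξ => ?_
  have hnorm : ∀ ζ : ℂ, 1 ≤ ‖(!₂[1, ζ] : C2)‖ := by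
    intro ζ
    have := PiLp.norm_apply_le (!₂[1, ζ] : C2) 0
    simpa using this
  have hproj : ∀ ζ : ℂ, lineProj (affineLine ζ) =
      (ℂ ∙ (((‖(!₂[1, ζ] : C2)‖⁻¹ : ℝ) : ℂ) • (!₂[1, ζ] : C2))).starProjection := by
    intro ζ
    rw [lineProj]
    congr 1
    rw [affineLine, Projectivization.submodule_mk, Submodule.span_singleton_smul_eq]
    refine IsUnit.mk0 _ ?_
    rw [Complex.ofReal_ne_zero]
    exact inv_ne_zero (by linarith [hnorm ζ])
  have hunit : ∀ ζ : ℂ, ‖((‖(!₂[1, ζ] : C2)‖⁻¹ : ℝ) : ℂ) • (!₂[1, ζ] : C2)‖ = 1 := by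
    intro ζ
    rw [norm_smul, Complex.norm_real, Real.norm_of_nonneg (inv_nonneg.2 (norm_nonneg _)),
      inv_mul_cancel₀]
    linarith [hnorm ζ]
  have hdist : dist (affineLine ζ) (affineLine ξ) =
      ‖lineProj (affineLine ζ) - lineProj (affineLine ξ)‖ :=
    dist_eq_norm (lineProj (affineLine ζ)) (lineProj (affineLine ξ))
  have hvec : ‖(!₂[1, ζ] : C2) - !₂[1, ξ]‖ = dist ζ ξ := by
    rw [EuclideanSpace.norm_eq, dist_eq_norm]
    simp
  rw [hdist, hproj, hproj]
  refine (norm_starProjection_singleton_sub_le (hunit ζ) (hunit ξ)).trans ?_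
  have := norm_unit_sub_unit_le (hnorm ζ) (affineVec_ne_zero ξ)
  rw [hvec] at this
  rw [NNReal.coe_ofNat]
  linarith

/-! ### Regularity of the logarithmic moment -/

theorem integrable_log_abs_sub {φ : Lp ℝ ∞ arc} {lam δ : ℝ} (hδ : 0 < δ)
    (h : ∀ᵐ t ∂arc, δ ≤ |φ t - lam|) : Integrable (fun t => Real.log |φ t - lam|) arc := by
  have hφ : Integrable φ arc := (Lp.memLp φ).integrable le_top
  have hd : Integrable (fun t => φ t - lam) arc := hφ.sub (integrable_const lam)
  refine Integrable.mono' (hd.abs.add (integrable_const |Real.log δ|))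
    (Real.measurable_log.comp_aemeasurable hd.abs.1.aemeasurable).aestronglyMeasurable ?_
  filter_upwards [h] with t ht
  have h1 := Real.log_le_log hδ ht
  have h2 := Real.log_le_sub_one_of_pos (hδ.trans_le ht)
  have h3 := neg_abs_le (Real.log δ)
  have h4 := abs_nonneg (Real.log δ)
  simp only [Pi.add_apply]
  rw [Real.norm_eq_abs, abs_le]
  constructor
  · linarith [abs_nonneg (φ t - lam)]
  · linarith

theorem abs_log_sub_log_le {x y δ : ℝ} (hδ : 0 < δ) (hx : δ ≤ x) (hy : δ ≤ y) :
    |Real.log x - Real.log y| ≤ |x - y| / δ := by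
  have key : ∀ x y : ℝ, δ ≤ x → δ ≤ y → Real.log x - Real.log y ≤ |x - y| / δ := by
    intro x y hx hy
    have hx0 := hδ.trans_le hx
    have hy0 := hδ.trans_le hy
    rw [← Real.log_div hx0.ne' hy0.ne']
    refine (Real.log_le_sub_one_of_pos (div_pos hx0 hy0)).trans ?_
    rw [div_sub_one hy0.ne']
    exact div_le_div₀ (abs_nonneg _) (le_abs_self _) hδ hy
  rw [abs_le]
  constructor
  · have := key y x hy hx
    rw [abs_sub_comm] at this
    linarith
  · exact key x y hx hy

/-- The logarithm is `1/δ`-Lipschitz on `[δ, ∞)`, and the measure has total mass one. -/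
theorem dist_logMoment_le {φ : Lp ℝ ∞ arc} {lam lam' δ : ℝ} (hδ : 0 < δ)
    (h : ∀ᵐ t ∂arc, δ ≤ |φ t - lam|) (h' : ∀ᵐ t ∂arc, δ ≤ |φ t - lam'|) :
    dist (logMoment φ lam) (logMoment φ lam') ≤ δ⁻¹ * dist lam lam' := by
  rw [dist_eq_norm, logMoment, logMoment, neg_sub_neg,
    ← integral_sub (integrable_conj_fourier_one_mul (integrable_log_abs_sub hδ h'))
      (integrable_conj_fourier_one_mul (integrable_log_abs_sub hδ h))]
  have hb := norm_integral_le_of_norm_le_const (μ := arc) (C := δ⁻¹ * dist lam lam')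
    (f := fun t => conj (fourier 1 t) * (Real.log |φ t - lam'| : ℂ) -
      conj (fourier 1 t) * (Real.log |φ t - lam| : ℂ)) (by
    filter_upwards [h, h'] with t h1 h2
    rw [← mul_sub, norm_mul, Complex.norm_conj, norm_fourier_apply, one_mul,
      ← Complex.ofReal_sub, Complex.norm_real, Real.norm_eq_abs]
    refine (abs_log_sub_log_le hδ h2 h1).trans ?_
    rw [div_eq_inv_mul, Real.dist_eq]
    refine mul_le_mul_of_nonneg_left ?_ (inv_nonneg.2 hδ.le)
    refine (abs_abs_sub_abs_le (φ t - lam') (φ t - lam)).trans_eq ?_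
    congr 1
    ring)
  simpa using hb

theorem ae_le_abs_sub {φ : Lp ℝ ∞ arc} {c : ℂ} (hc : c ≠ 0) {m M : ℝ}
    (hm : ∀ᵐ t ∂arc, neilWeight c t < 0 → φ t ≤ m)
    (hM : ∀ᵐ t ∂arc, 0 < neilWeight c t → M ≤ φ t) {lam δ : ℝ} (h1 : m + δ ≤ lam)
    (h2 : lam ≤ M - δ) : ∀ᵐ t ∂arc, δ ≤ |φ t - lam| := by
  filter_upwards [hm, hM, ae_neilWeight_ne_zero hc] with t hm hM hne
  rcases lt_or_gt_of_ne hne with h | h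
  · rw [abs_sub_comm]
    exact le_trans (by linarith [hm h]) (le_abs_self _)
  · exact le_trans (by linarith [hM h]) (le_abs_self _)

theorem locallyLipschitzOn_logMoment {φ : Lp ℝ ∞ arc} {c : ℂ} (hc : c ≠ 0) {m M : ℝ}
    (hm : ∀ᵐ t ∂arc, neilWeight c t < 0 → φ t ≤ m)
    (hM : ∀ᵐ t ∂arc, 0 < neilWeight c t → M ≤ φ t) :
    LocallyLipschitzOn (Ioo m M) (logMoment φ) := by
  intro x hx
  obtain ⟨δ, hδ, hδ1, hδ2⟩ : ∃ δ : ℝ, 0 < δ ∧ m + δ < x ∧ x < M - δ := by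
    refine ⟨min (x - m) (M - x) / 2, ?_, ?_, ?_⟩
    · have : 0 < min (x - m) (M - x) := lt_min (sub_pos.2 hx.1) (sub_pos.2 hx.2)
      linarith
    · have h1 := min_le_left (x - m) (M - x)
      linarith [hx.1]
    · have h1 := min_le_right (x - m) (M - x)
      linarith [hx.2]
  refine ⟨⟨δ⁻¹, (inv_pos.2 hδ).le⟩, Ioo (m + δ) (M - δ),
    mem_nhdsWithin_of_mem_nhds (Ioo_mem_nhds hδ1 hδ2), ?_⟩
  refine LipschitzOnWith.of_dist_le_mul fun a ha b hb => ?_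
  exact dist_logMoment_le hδ (ae_le_abs_sub hc hm hM ha.1.le ha.2.le)
    (ae_le_abs_sub hc hm hM hb.1.le hb.2.le)

theorem dimH_image_le_one_of_locallyLipschitzOn {X : Type*} [EMetricSpace X] {f : ℝ → X}
    {s : Set ℝ} (hf : LocallyLipschitzOn s f) : dimH (f '' s) ≤ 1 :=
  (dimH_image_le_of_locally_lipschitzOn fun _ hx => hf hx).trans
    ((dimH_mono (subset_univ s)).trans_eq Real.dimH_univ)

/-! ### A family of one-dimensional subspaces -/

/-- The vector `z - ζ^*`. -/
noncomputable def slopeVec (ζ : ℂ) : L2 := fourierLp 2 1 - conj ζ • fourierLp 2 0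

/-- The span of `z - ζ^*`; the functions of `H²` orthogonal to it are those with
`f'(0) = ζ f(0)`. -/
noncomputable def slopeSpan (ζ : ℂ) : Submodule ℂ L2 := Submodule.span ℂ {slopeVec ζ}

theorem inner_fourierLp_fourierLp (i j : ℤ) :
    inner ℂ (fourierLp 2 i : L2) (fourierLp 2 j : L2) = if i = j then 1 else 0 :=
  orthonormal_iff_ite.1 orthonormal_fourier i j

theorem inner_fourierLp_one_slopeVec (ζ : ℂ) :
    inner ℂ (fourierLp 2 1 : L2) (slopeVec ζ) = 1 := by
  rw [slopeVec, inner_sub_right, inner_smul_right, inner_fourierLp_fourierLp,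
    inner_fourierLp_fourierLp]
  simp

theorem inner_fourierLp_zero_slopeVec (ζ : ℂ) :
    inner ℂ (fourierLp 2 0 : L2) (slopeVec ζ) = -conj ζ := by
  rw [slopeVec, inner_sub_right, inner_smul_right, inner_fourierLp_fourierLp,
    inner_fourierLp_fourierLp]
  simp

theorem slopeVec_mem (ζ : ℂ) : slopeVec ζ ∈ slopeSpan ζ := Submodule.mem_span_singleton_self _

theorem slopeSpan_ne_bot (ζ : ℂ) : slopeSpan ζ ≠ ⊥ := by
  rw [slopeSpan, Ne, Submodule.span_singleton_eq_bot]
  intro h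
  have := inner_fourierLp_one_slopeVec ζ
  rw [h, inner_zero_right] at this
  exact zero_ne_one this

theorem slopeSpan_injective : Function.Injective slopeSpan := by
  intro ζ ξ h
  have h1 : slopeVec ζ ∈ slopeSpan ξ := h ▸ slopeVec_mem ζ
  obtain ⟨k, hk⟩ := Submodule.mem_span_singleton.1 h1
  have h2 := congrArg (inner ℂ (fourierLp 2 1 : L2)) hk
  have h3 := congrArg (inner ℂ (fourierLp 2 0 : L2)) hk
  rw [inner_smul_right, inner_fourierLp_one_slopeVec, inner_fourierLp_one_slopeVec, mul_one] at h2
  rw [inner_smul_right, inner_fourierLp_zero_slopeVec, inner_fourierLp_zero_slopeVec, h2, one_mul,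
    neg_inj] at h3
  exact (star_injective h3).symm

theorem fourierLp_zero_notMem_slopeSpan (ζ : ℂ) : (fourierLp 2 0 : L2) ∉ slopeSpan ζ := by
  intro h
  obtain ⟨k, hk⟩ := Submodule.mem_span_singleton.1 h
  have h2 := congrArg (inner ℂ (fourierLp 2 1 : L2)) hk
  rw [inner_smul_right, inner_fourierLp_one_slopeVec, mul_one, inner_fourierLp_fourierLp,
    if_neg one_ne_zero] at h2
  have h3 := inner_fourierLp_fourierLp 0 0
  rw [← hk, h2, zero_smul, inner_zero_left, if_pos rfl] at h3
  exact zero_ne_one h3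

theorem slopeSpan_ne_constants (ζ : ℂ) : slopeSpan ζ ≠ constants := by
  intro h
  refine fourierLp_zero_notMem_slopeSpan ζ ?_
  rw [h]
  exact Submodule.mem_span_singleton_self _

theorem slopeSpan_lt_linearPolys (ζ : ℂ) : slopeSpan ζ < linearPolys := by
  have h0 : (fourierLp 2 0 : L2) ∈ linearPolys := Submodule.subset_span (by simp)
  have h1 : (fourierLp 2 1 : L2) ∈ linearPolys := Submodule.subset_span (by simp)
  refine lt_of_le_of_ne ?_ fun h => fourierLp_zero_notMem_slopeSpan ζ (h ▸ h0)
  rw [slopeSpan, Submodule.span_singleton_le_iff_mem]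
  exact Submodule.sub_mem _ h1 (Submodule.smul_mem _ _ h0)

theorem coeff_ratio_of_mem_hardySub_slopeSpan {ζ : ℂ} {f : L2} (hf : f ∈ hardySub (slopeSpan ζ))
    (h0 : fourierCoeff f 0 ≠ 0) : fourierCoeff f 1 / fourierCoeff f 0 = ζ := by
  have h := (Submodule.mem_orthogonal _ _).1 hf.2 _ (slopeVec_mem ζ)
  rw [slopeVec, inner_sub_left, inner_smul_left, inner_fourierLp, inner_fourierLp,
    Complex.conj_conj, sub_eq_zero] at h
  rw [h, mul_div_cancel_right₀ _ h0]

/-- The plane has dimension two, and a finite set adds nothing to the dimension. -/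
theorem infinite_compl_of_dimH_le_one {s : Set ℂ} (hs : dimH s ≤ 1) : sᶜ.Infinite := by
  intro hfin
  have h1 : dimH (s ∪ sᶜ) ≤ 1 := by
    rw [dimH_union, dimH_finite hfin]
    simpa using hs
  rw [union_compl_self, Real.dimH_univ_eq_finrank, Complex.finrank_real_complex] at h1
  norm_num at h1

/-! ### Essential bounds as almost-everywhere inequalities -/

theorem ae_le_of_essSup_eq {u : Torus → ℝ} {s : Set Torus} (hs : MeasurableSet s) {m : ℝ}
    (h : essSup (fun t => ((u t : ℝ) : EReal)) (arc.restrict s) = (m : EReal)) :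
    (∀ᵐ t ∂arc, t ∈ s → u t ≤ m) ∧ ∀ r : ℝ, (∀ᵐ t ∂arc, t ∈ s → u t ≤ r) → m ≤ r := by
  constructor
  · rw [← ae_restrict_iff' hs]
    filter_upwards [ae_le_essSup (f := fun t => ((u t : ℝ) : EReal)) (μ := arc.restrict s)]
      with t ht
    rw [h] at ht
    exact_mod_cast ht
  · intro r hr
    rw [← ae_restrict_iff' hs] at hr
    have h1 : essSup (fun t => ((u t : ℝ) : EReal)) (arc.restrict s) ≤ (r : EReal) :=
      essSup_le_of_ae_le _ (hr.mono fun t ht => EReal.coe_le_coe_iff.2 ht)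
    rw [h] at h1
    exact_mod_cast h1

theorem ae_le_of_essInf_eq {u : Torus → ℝ} {s : Set Torus} (hs : MeasurableSet s) {m : ℝ}
    (h : essInf (fun t => ((u t : ℝ) : EReal)) (arc.restrict s) = (m : EReal)) :
    (∀ᵐ t ∂arc, t ∈ s → m ≤ u t) ∧ ∀ r : ℝ, (∀ᵐ t ∂arc, t ∈ s → r ≤ u t) → r ≤ m := by
  constructor
  · rw [← ae_restrict_iff' hs]
    filter_upwards [ae_essInf_le (f := fun t => ((u t : ℝ) : EReal)) (μ := arc.restrict s)]
      with t ht
    rw [h] at ht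
    exact_mod_cast ht
  · intro r hr
    rw [← ae_restrict_iff' hs] at hr
    have h1 : (r : EReal) ≤ essInf (fun t => ((u t : ℝ) : EReal)) (arc.restrict s) :=
      le_essInf_of_ae_le _ (hr.mono fun t ht => EReal.coe_le_coe_iff.2 ht)
    rw [h] at h1
    exact_mod_cast h1

theorem continuous_neilWeight (c : ℂ) : Continuous (neilWeight c) :=
  continuous_const.mul (Complex.continuous_re.comp
    (continuous_const.mul (map_continuous (fourier (T := 2 * Real.pi) 1))))

end NeilParabola

theorem corollary3p5 (φ : Lp ℝ ∞ arc) (c : ℂ) (m M : ℝ)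
    (hm : essSup (fun t => ((φ t : ℝ) : EReal)) (arc.restrict {t | neilWeight c t < 0})
      = (m : EReal))
    (hM : essInf (fun t => ((φ t : ℝ) : EReal)) (arc.restrict {t | 0 < neilWeight c t})
      = (M : EReal))
    (hm0 : m < 0) (hM0 : 0 < M) :
    -- the functions that define `Λ` make sense
    (Integrable (hLog c) arc ∧ DifferentiableAt ℂ (hFun c) 0 ∧
      ∀ lam ∈ Ioo m M, Integrable (gLog φ lam) arc ∧ DifferentiableAt ℂ (gFun φ lam) 0) ∧
    -- `Λ` is locally Lipschitz on `(m, M)`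
    LocallyLipschitzOn (Ioo m M) (lamMap c φ) ∧
    -- its image has Hausdorff dimension at most one
    dimH (lamMap c φ '' Ioo m M) ≤ 1 ∧
    -- there are no eigenvalues for the span of `1`
    NoEigenvalues φ constants ∧
    -- nor for infinitely many other nonzero proper subspaces of `ℂ ⊕ ℂ z`
    {V : Submodule ℂ L2 | V ≠ ⊥ ∧ V < linearPolys ∧ V ≠ constants ∧ NoEigenvalues φ V}.Infinite := by
  -- For `c = 0` the set is empty and the essential supremum is `⊥`, not a real number.
  have hc : c ≠ 0 := by
    rintro rfl
    simp [neilWeight] at hm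
  obtain ⟨hm1, hm2⟩ := ae_le_of_essSup_eq
    (measurableSet_lt (continuous_neilWeight c).measurable measurable_const) hm
  obtain ⟨hM1, hM2⟩ := ae_le_of_essInf_eq
    (measurableSet_lt measurable_const (continuous_neilWeight c).measurable) hM
  simp only [mem_ofPred_eq] at hm1 hm2 hM1 hM2
  have hg : ∀ lam ∈ Ioo m M, Integrable (gLog φ lam) arc := by
    intro lam hlam
    rw [funext (gLog_eq φ lam)]
    refine (integrable_log_abs_sub (δ := min (lam - m) (M - lam))
      (lt_min (sub_pos.2 hlam.1) (sub_pos.2 hlam.2)) ?_).const_mul _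
    refine ae_le_abs_sub hc hm1 hM1 ?_ ?_
    · linarith [min_le_left (lam - m) (M - lam)]
    · linarith [min_le_right (lam - m) (M - lam)]
  have hLip : LocallyLipschitzOn (Ioo m M) (logMoment φ) :=
    locallyLipschitzOn_logMoment hc hm1 hM1
  have hLam : LocallyLipschitzOn (Ioo m M) (lamMap c φ) := by
    intro x hx
    obtain ⟨K, t, ht, hK⟩ := hLip hx
    -- Shrinking to the interval makes the formula `[1 : logMoment]` available at every point.
    refine ⟨4 * K, t ∩ Ioo m M, Filter.inter_mem ht self_mem_nhdsWithin, ?_⟩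
    intro y hy z hz
    rw [lamMap_eq_affineLine hc (hg y hy.2), lamMap_eq_affineLine hc (hg z hz.2)]
    exact lipschitzWith_affineLine.comp_lipschitzOnWith (hK.mono inter_subset_left) hy hz
  have hno : ∀ V : Submodule ℂ L2, V ≤ linearPolys → (∀ lam ∈ Icc m M, ∀ f ∈ hardySub V,
      fourierCoeff f 0 ≠ 0 → fourierCoeff f 1 / fourierCoeff f 0 ≠ logMoment φ lam) →
      NoEigenvalues φ V := by
    intro V hV hne μ hμ
    obtain ⟨lam, hlam, f, hf, h0, h1⟩ := exists_coeff_ratio_of_hasEigenvalue hc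
      (hm0.trans hM0) hm1 hm2 hM1 hM2 hV hμ
    exact hne lam hlam f hf h0 h1
  refine ⟨⟨integrable_hLog hc, (hasDerivAt_outerExp_zero (integrable_hLog hc)).differentiableAt,
    fun lam hlam => ⟨hg lam hlam, (hasDerivAt_outerExp_zero (hg lam hlam)).differentiableAt⟩⟩,
    hLam, dimH_image_le_one_of_locallyLipschitzOn hLam, ?_, ?_⟩
  -- Orthogonality to `1` says `f̂(0) = 0`, which no eigenvector satisfies.
  · refine hno _ (Submodule.span_mono (by simp)) fun lam _ f hf h0 => absurd ?_ h0
    rw [← inner_fourierLp]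
    exact (Submodule.mem_orthogonal _ _).1 hf.2 _ (Submodule.mem_span_singleton_self _)
  -- Eigenvalues at `m` and `M` are not excluded, so the closed interval is needed. Its endpoints
  -- contribute at most two points, whatever values `logMoment` takes there.
  · have hdim : dimH (logMoment φ '' Icc m M) ≤ 1 := by
      rw [← Ioo_union_both (hm0.trans hM0).le, image_union, dimH_union,
        dimH_finite ((toFinite {m, M}).image _)]
      simpa using dimH_image_le_one_of_locallyLipschitzOn hLip
    -- Each `ζ` off the curve gives a good subspace, and distinct `ζ` give distinct subspaces.
    refine ((infinite_compl_of_dimH_le_one hdim).image slopeSpan_injective.injOn).mono ?_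
    rintro _ ⟨ζ, hζ, rfl⟩
    refine ⟨slopeSpan_ne_bot ζ, slopeSpan_lt_linearPolys ζ, slopeSpan_ne_constants ζ,
      hno _ (slopeSpan_lt_linearPolys ζ).le fun lam hlam f hf h0 h1 => hζ ⟨lam, hlam, ?_⟩⟩
    rw [← h1, coeff_ratio_of_mem_hardySub_slopeSpan hf h0]
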